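/- Let $V$ be a finite set with $n$ elements. A *distance matrix* on $V$ is a symmetric function $D:V\times V\to\mathbb{R}_{\ge 0}$ with $D(u,u)=0$ for all $u$. A *tree metric* on $V$ is a matrix of the form $T(u,v)=d(x_u,x_v)$, where $d$ is the path-length metric of a finite tree with non-negative edge lengths and $u\mapsto x_u$ is a (not necessarily injective or surjective) map from $V$ to its nodes; it is an *ultrametric* if the tree and a root can be chosen so that all $x_u$ have the same distance from the root. Write $\|A-B\|_0$ for the number of unordered pairs $\{u,v\}$, $u\neq v$, with $A(u,v)\neq B(u,v)$. In $L_0$ Fitting Tree Metrics (respectively $L_0$ Fitting Ultrametrics) the input is a distance matrix $D$ and the goal is to output a tree metric (respectively ultrametric) $T$ minimizing $\|T-D\|_0$. A factor-$\rho$ approximation always outputs a feasible $T$ with $\|T-D\|_0\le\rho\,\|S-D\|_0$ for every feasible $S$. Algorithms are real RAM programs (exact real arithmetic and comparisons at unit cost, integer addition and subtraction for addressing), and running times are measured in the number $n$ of elements. **Theorem.** A factor $\rho\ge 1$ approximation for $L_0$ Fitting Ultrametrics implies, in a black-box fashion, a factor $6\rho$ approximation for $L_0$ Fitting Tree Metrics.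 Precisely: there are a single oracle program $P$ and a polynomial $q$ such that for every real $\rho\ge 1$ and every $t:\mathbb{N}\to\mathbb{N}$ the following hold. 1. If a black box $O$ (any function from matrices to matrices of the same size) is a factor-$\rho$ approximation for $L_0$ Fitting Ultrametrics that takes time at most $t(n)$ on every distance matrix on $n$ elements, then $P$ with oracle $O$ is a factor-$6\rho$ approximation for $L_0$ Fitting Tree Metrics with total running time at most $n\,t(n)+q(n)$, the time taken by $O$ included. 2. If a program $A$ without oracle is a factor-$\rho$ approximation algorithm for $L_0$ Fitting Ultrametrics with running time at most $t(n)$, then the program obtained from $P$ by using $A$ in place of the oracle is a factor-$6\rho$ approximation algorithm for $L_0$ Fitting Tree Metrics with running time at most $n\,t(n)+q(n)$. In particular, a polynomial-time factor-$\rho$ approximation for ultrametrics yields a polynomial-time factor-$6\rho$ approximation for tree metrics. -/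

import Mathlib

open scoped NNReal

namespace L0Fit

/-! ### Distance matrices, tree metrics, ultrametrics, and the `L₀` objective -/

/-- Square matrices indexed by the ground set `V = {0, …, n - 1}`. -/
abbrev Mat (n : ℕ) : Type := Fin n → Fin n → ℝ

/-- A function from the unordered pairs to the non-negative reals, extended by `D u u = 0`. -/
structure IsDistanceMatrix {n : ℕ} (D : Mat n) : Prop where
  diag : ∀ u, D u u = 0
  symm : ∀ u v, D u v = D v u
  nonneg : ∀ u v, 0 ≤ D u v

/-- A finite tree with non-negative edge lengths (only the values of `length` on edges matter). -/
structure WeightedTree where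
  Node : Type
  finite : Finite Node
  graph : SimpleGraph Node
  isTree : graph.IsTree
  length : Sym2 Node → ℝ≥0

/-- The total length of the unique path between two nodes. -/
noncomputable def WeightedTree.dist (T : WeightedTree) (x y : T.Node) : ℝ :=
  (((T.isTree.existsUnique_path x y).choose.edges.map T.length).sum : ℝ≥0)

/-- `M` is the path metric of a weighted tree, restricted to the nodes that the elements of `V`
are mapped to.  Auxiliary nodes, and several elements at one node, are allowed. -/
def IsTreeMetric {n : ℕ} (M : Mat n) : Prop :=
  ∃ (T : WeightedTree) (node : Fin n → T.Node), ∀ u v, M u v = T.dist (node u) (node v)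

/-- `M` is the path metric of a rooted weighted tree in which all elements of `V` lie at the same
depth (whatever hangs below or beside them is irrelevant for `M`, so these nodes may be thought of
as the leaves). -/
def IsUltrametric {n : ℕ} (M : Mat n) : Prop :=
  ∃ (T : WeightedTree) (node : Fin n → T.Node) (root : T.Node) (depth : ℝ),
    (∀ u, T.dist root (node u) = depth) ∧ ∀ u v, M u v = T.dist (node u) (node v)

open Classical in
/-- `‖A - B‖₀`: the number of unordered pairs on which two symmetric matrices disagree. -/
noncomputable def disagreements {n : ℕ} (A B : Mat n) : ℕ :=
  (Finset.univ.filter fun p : Fin n × Fin n => p.1 < p.2 ∧ A p.1 p.2 ≠ B p.1 p.2).card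

/-- `R` is a feasible output for the input `D` whose cost is at most `ρ` times the cost of every
feasible output (hence at most `ρ` times the optimum). -/
def IsApproxSolution (Feasible : ∀ {n : ℕ}, Mat n → Prop) (ρ : ℝ) {n : ℕ} (D R : Mat n) : Prop :=
  Feasible R ∧ ∀ S : Mat n, Feasible S → (disagreements R D : ℝ) ≤ ρ * disagreements S D

/-! ### Real RAM programs with oracle calls

The memory consists of integer arrays (indexed by one natural number) and real arrays (indexed by
two natural numbers), addressed indirectly.  Integers admit addition and truncated subtraction,
reals admit the four field operations (`x / 0 = 0`) and exact comparison. -/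

/-- Integer expressions; `cell a i` is entry `i` of integer array number `a`. -/
inductive NExp where
  | const (k : ℕ)
  | cell (a : ℕ) (i : NExp)
  | add (e f : NExp)
  | sub (e f : NExp)

/-- Real expressions; `cell a i j` is entry `(i, j)` of real array number `a`. -/
inductive RExp where
  | ofNat (e : NExp)
  | cell (a : ℕ) (i j : NExp)
  | add (e f : RExp)
  | sub (e f : RExp)
  | mul (e f : RExp)
  | div (e f : RExp)

/-- Tests. -/
inductive BExp where
  | leN (e f : NExp)
  | leR (e f : RExp)
  | not (b : BExp)
  | and (b c : BExp)

/-- Programs.  `oracle k src dst` asks the oracle about the matrix formed by the entries `(i, j)`,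
`i, j < k`, of real array `src`, and writes the answer to real array `dst`; `call Q k src dst` does
the same with the program `Q`, run in a fresh memory, in the role of the oracle. -/
inductive Prog where
  | nop
  | setN (a : ℕ) (i e : NExp)
  | setR (a : ℕ) (i j : NExp) (e : RExp)
  | seq (p q : Prog)
  | ite (b : BExp) (p q : Prog)
  | loop (b : BExp) (p : Prog)
  | oracle (k : NExp) (src dst : ℕ)
  | call (Q : Prog) (k : NExp) (src dst : ℕ)

/-- The memory. -/
structure Store where
  int : ℕ → ℕ → ℕ
  real : ℕ → ℕ → ℕ → ℝ

namespace Store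

/-- The initial memory on input `D`: the size `n` in entry `0` of integer array `0`, the matrix `D`
in real array `0`, and zeros everywhere else. -/
noncomputable def init {n : ℕ} (D : Mat n) : Store where
  int a i := if a = 0 ∧ i = 0 then n else 0
  real a i j := if h : a = 0 ∧ i < n ∧ j < n then D ⟨i, h.2.1⟩ ⟨j, h.2.2⟩ else 0

/-- The `n × n` matrix stored in real array `a`. -/
def read (s : Store) (a n : ℕ) : Mat n := fun i j => s.real a i j

/-- Overwrite the upper left `n × n` part of real array `a` by `M`. -/
noncomputable def write (s : Store) (a : ℕ) {n : ℕ} (M : Mat n) : Store where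
  int := s.int
  real b i j :=
    if h : b = a ∧ i < n ∧ j < n then M ⟨i, h.2.1⟩ ⟨j, h.2.2⟩ else s.real b i j

/-- Overwrite one integer cell. -/
def setInt (s : Store) (a i x : ℕ) : Store where
  int b k := if b = a ∧ k = i then x else s.int b k
  real := s.real

/-- Overwrite one real cell. -/
noncomputable def setReal (s : Store) (a i j : ℕ) (x : ℝ) : Store where
  int := s.int
  real b k l := if b = a ∧ k = i ∧ l = j then x else s.real b k l

end Store

/-- Value of an integer expression. -/
def NExp.eval (s : Store) : NExp → ℕ
  | .const k => k
  | .cell a i => s.int a (i.eval s)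
  | .add e f => e.eval s + f.eval s
  | .sub e f => e.eval s - f.eval s

/-- Value of a real expression. -/
noncomputable def RExp.eval (s : Store) : RExp → ℝ
  | .ofNat e => (e.eval s : ℝ)
  | .cell a i j => s.real a (i.eval s) (j.eval s)
  | .add e f => e.eval s + f.eval s
  | .sub e f => e.eval s - f.eval s
  | .mul e f => e.eval s * f.eval s
  | .div e f => e.eval s / f.eval s

/-- Truth of a test. -/
def BExp.holds (s : Store) : BExp → Prop
  | .leN e f => e.eval s ≤ f.eval s
  | .leR e f => e.eval s ≤ f.eval s
  | .not b => ¬ b.holds s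
  | .and b c => b.holds s ∧ c.holds s

/-- Number of operations performed by evaluating an integer expression. -/
def NExp.size : NExp → ℕ
  | .const _ => 1
  | .cell _ i => i.size + 1
  | .add e f => e.size + f.size + 1
  | .sub e f => e.size + f.size + 1

/-- Number of operations performed by evaluating a real expression. -/
def RExp.size : RExp → ℕ
  | .ofNat e => e.size + 1
  | .cell _ i j => i.size + j.size + 1
  | .add e f => e.size + f.size + 1
  | .sub e f => e.size + f.size + 1
  | .mul e f => e.size + f.size + 1
  | .div e f => e.size + f.size + 1

/-- Number of operations performed by evaluating a test. -/
def BExp.size : BExp → ℕ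
  | .leN e f => e.size + f.size + 1
  | .leR e f => e.size + f.size + 1
  | .not b => b.size + 1
  | .and b c => b.size + c.size + 1

/-- A black box that turns matrices into matrices of the same size: on a query it gives an answer
together with the time it took, or (`none`) never answers. -/
abbrev Oracle : Type := ∀ n : ℕ, Mat n → Option (Mat n × ℕ)

/-- The oracle that never answers.  A program that halts with it makes no oracle call. -/
def noOracle : Oracle := fun _ _ => none

/-- `Exec O p s s' c`: with oracle `O`, program `p` started in memory `s` halts in memory `s'` after
`c` steps.  Copying a query and its answer is charged one step per entry, and the time taken by the
oracle or by the called program is counted. -/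
inductive Exec (O : Oracle) : Prog → Store → Store → ℕ → Prop where
  | nop (s : Store) : Exec O .nop s s 1
  | setN (s : Store) (a : ℕ) (i e : NExp) :
      Exec O (.setN a i e) s (s.setInt a (i.eval s) (e.eval s)) (i.size + e.size + 1)
  | setR (s : Store) (a : ℕ) (i j : NExp) (e : RExp) :
      Exec O (.setR a i j e) s (s.setReal a (i.eval s) (j.eval s) (e.eval s))
        (i.size + j.size + e.size + 1)
  | seq {p q : Prog} {s s' s'' : Store} {c d : ℕ} :
      Exec O p s s' c → Exec O q s' s'' d → Exec O (.seq p q) s s'' (c + d)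
  | ite_true {b : BExp} {p q : Prog} {s s' : Store} {c : ℕ} :
      b.holds s → Exec O p s s' c → Exec O (.ite b p q) s s' (b.size + c)
  | ite_false {b : BExp} {p q : Prog} {s s' : Store} {c : ℕ} :
      ¬ b.holds s → Exec O q s s' c → Exec O (.ite b p q) s s' (b.size + c)
  | loop_true {b : BExp} {p : Prog} {s s' s'' : Store} {c d : ℕ} :
      b.holds s → Exec O p s s' c → Exec O (.loop b p) s' s'' d →
      Exec O (.loop b p) s s'' (b.size + c + d)
  | loop_false {b : BExp} {p : Prog} {s : Store} :
      ¬ b.holds s → Exec O (.loop b p) s s b.size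
  | oracle {k : NExp} {src dst : ℕ} {s : Store} {R : Mat (k.eval s)} {c : ℕ} :
      O (k.eval s) (s.read src (k.eval s)) = some (R, c) →
      Exec O (.oracle k src dst) s (s.write dst R) (k.size + 2 * k.eval s ^ 2 + c + 1)
  | call {Q : Prog} {k : NExp} {src dst : ℕ} {s s' : Store} {c : ℕ} :
      Exec O Q (Store.init (s.read src (k.eval s))) s' c →
      Exec O (.call Q k src dst) s (s.write dst (s'.read 1 (k.eval s)))
        (k.size + 2 * k.eval s ^ 2 + c + 1)

/-- `P.subst A` is the program `P` with the oracle replaced by the program `A`. -/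
def Prog.subst (P A : Prog) : Prog :=
  match P with
  | .nop => .nop
  | .setN a i e => .setN a i e
  | .setR a i j e => .setR a i j e
  | .seq p q => .seq (p.subst A) (q.subst A)
  | .ite b p q => .ite b (p.subst A) (q.subst A)
  | .loop b p => .loop b (p.subst A)
  | .oracle k src dst => .call A k src dst
  | .call Q k src dst => .call (Q.subst A) k src dst

/-- With oracle `O`, program `p` halts on input `D` after `c` steps with `R` in the output array,
which is real array `1`. -/
def Prog.Computes (O : Oracle) (p : Prog) {n : ℕ} (D R : Mat n) (c : ℕ) : Prop :=
  ∃ s : Store, Exec O p (Store.init D) s c ∧ s.read 1 n = R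

/-- With oracle `O`, program `p` is a factor `ρ` approximation algorithm for `L₀` fitting of
distance matrices on `n` elements by `Feasible` matrices, with running time at most `t n`. -/
def IsApproxAlgorithm (Feasible : ∀ {n : ℕ}, Mat n → Prop) (O : Oracle) (p : Prog) (ρ : ℝ)
    (t : ℕ → ℕ) : Prop :=
  ∀ (n : ℕ) (D : Mat n), IsDistanceMatrix D →
    ∃ (R : Mat n) (c : ℕ), p.Computes O D R c ∧ IsApproxSolution Feasible ρ D R ∧ c ≤ t n

/-- The same for a black box. -/
def IsApproxOracle (Feasible : ∀ {n : ℕ}, Mat n → Prop) (O : Oracle) (ρ : ℝ)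
    (t : ℕ → ℕ) : Prop :=
  ∀ (n : ℕ) (D : Mat n), IsDistanceMatrix D →
    ∃ (R : Mat n) (c : ℕ), O n D = some (R, c) ∧ IsApproxSolution Feasible ρ D R ∧ c ≤ t n

end L0Fit

/-!
Fix an element `a` as pivot.  The Farris transform, which replaces `D u v` by
`D u v + 2 * r - D a u - D a v` for a large constant `r`, moves all elements to the same distance
from `a`, and turns the tree metrics with the given distances from `a` into the ultrametrics that
satisfy certain upper and lower bounds.  Clamping to the triangle inequalities with `a`, before the
transform and after its inverse, enforces these bounds, so an approximation for ultrametrics solves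
the problem restricted to trees with the given distances from `a`.

Let `T` be a tree metric with `k` disagreements.  A pair is bad for `a` if `T` is wrong on it, or on
the distance from `a` to one of its elements.  If `T` is wrong on `d a` distances from `a`, there
are at most `k + n * d a` bad pairs, and since `∑ a, d a = 2 * k`, at most `3 * k` on average.
Transforming `T` and raising to the maximum the distances of the elements whose distance from `a` is
wrong gives an ultrametric that errs only on bad pairs.  For a good pivot, a factor `ρ`
approximation therefore errs on at most `ρ * (3 * k)` pairs of the transformed problem, and its
pullback on these and the bad pairs only, hence on at most `3 * (ρ + 1) * k ≤ 6 * ρ * k` pairs.  The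
program tries all pivots.
-/

namespace L0Fit

/-! ### Distances in weighted trees -/

namespace WeightedTree

variable (T : WeightedTree)

theorem dist_eq_of_isPath {x y : T.Node} {p : T.graph.Walk x y} (hp : p.IsPath) :
    T.dist x y = ((p.edges.map T.length).sum : ℝ≥0) := by
  rw [(T.isTree.existsUnique_path x y).choose_spec.2 p hp, WeightedTree.dist]

theorem exists_isPath (x y : T.Node) : ∃ p : T.graph.Walk x y, p.IsPath :=
  (T.isTree.existsUnique_path x y).exists

theorem dist_nonneg (x y : T.Node) : 0 ≤ T.dist x y :=
  NNReal.coe_nonneg _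

theorem dist_self (x : T.Node) : T.dist x x = 0 := by
  simp [T.dist_eq_of_isPath SimpleGraph.Walk.IsPath.nil]

theorem dist_comm (x y : T.Node) : T.dist x y = T.dist y x := by
  obtain ⟨p, hp⟩ := T.exists_isPath x y
  simp [T.dist_eq_of_isPath hp, T.dist_eq_of_isPath hp.reverse, List.sum_reverse]

theorem dist_of_adj {x y : T.Node} (h : T.graph.Adj x y) : T.dist x y = T.length s(x, y) := by
  simp [T.dist_eq_of_isPath (SimpleGraph.Walk.IsPath.of_adj h)]

/-- Betweenness in a tree: the node `z` lies on the path from `x` to `y`. -/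
def Between (x z y : T.Node) : Prop :=
  ∃ (p : T.graph.Walk x z) (q : T.graph.Walk z y), (p.append q).IsPath

variable {T} {x y z w a : T.Node}

theorem between_of_mem_support {p : T.graph.Walk x y} (hp : p.IsPath) (hz : z ∈ p.support) :
    T.Between x z y := by
  obtain ⟨q, r, rfl⟩ := p.mem_support_iff_exists_append.mp hz
  exact ⟨q, r, hp⟩

theorem Between.mem_support (h : T.Between x z y) {p : T.graph.Walk x y} (hp : p.IsPath) :
    z ∈ p.support := by
  obtain ⟨q, r, hqr⟩ := h
  simp [(T.isTree.existsUnique_path x y).unique hp hqr]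

theorem Between.symm (h : T.Between x z y) : T.Between y z x := by
  obtain ⟨p, q, hpq⟩ := h
  exact ⟨q.reverse, p.reverse, by simpa using hpq.reverse⟩

theorem Between.dist_eq (h : T.Between x z y) : T.dist x y = T.dist x z + T.dist z y := by
  obtain ⟨q, r, hqr⟩ := h
  simp [T.dist_eq_of_isPath hqr, T.dist_eq_of_isPath hqr.of_append_left,
    T.dist_eq_of_isPath hqr.of_append_right]

theorem Between.trans_right (h : T.Between x z y) (h' : T.Between z w y) : T.Between x w y := by
  obtain ⟨q, r, hqr⟩ := h
  exact between_of_mem_support hqr (by simp [h'.mem_support hqr.of_append_right])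

theorem Between.total (h : T.Between x z y) (h' : T.Between x w y) :
    T.Between z w y ∨ T.Between w z y := by
  obtain ⟨q, r, hqr⟩ := h
  rcases (q.mem_support_append_iff r).mp (h'.mem_support hqr) with hw | hw
  · obtain ⟨q₁, q₂, rfl⟩ := q.mem_support_iff_exists_append.mp hw
    rw [← SimpleGraph.Walk.append_assoc] at hqr
    exact .inr ⟨q₂, r, hqr.of_append_right⟩
  · exact .inl (between_of_mem_support hqr.of_append_right hw)

theorem exists_median (x y a : T.Node) :
    ∃ z, T.Between x z y ∧ T.Between x z a ∧ T.Between y z a := by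
  classical
  obtain ⟨p, hp⟩ := T.exists_isPath x a
  obtain ⟨q, hq⟩ := T.exists_isPath y a
  -- the first node of the path from `x` to `a` that lies on the path from `y` to `a`
  obtain ⟨z, hzq, hzp, hz⟩ := p.exists_mem_support_forall_mem_support_imp_eq q.support.toFinset
    ⟨a, by simp⟩
  rw [List.mem_toFinset] at hzq
  refine ⟨z, ⟨p.takeUntil z hzp, (q.takeUntil z hzq).reverse, ?_⟩,
    between_of_mem_support hp hzp, between_of_mem_support hq hzq⟩
  have hq' := (hq.takeUntil hzq).reverse.support_nodup
  rw [SimpleGraph.Walk.isPath_def, SimpleGraph.Walk.support_append, List.nodup_append']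
  refine ⟨(hp.takeUntil hzp).support_nodup, hq'.tail, fun t ht ht' => ?_⟩
  have htq : t ∈ (q.takeUntil z hzq).support := by simpa using List.mem_of_mem_tail ht'
  obtain rfl : t = z := hz t (by simpa using q.support_takeUntil_subset_support hzq htq) ht
  rw [← SimpleGraph.Walk.cons_tail_support] at hq'
  exact (List.nodup_cons.mp hq').1 ht'

theorem dist_triangle (x z y : T.Node) : T.dist x y ≤ T.dist x z + T.dist z y := by
  obtain ⟨w, hxy, hxz, hyz⟩ := exists_median x y z
  have := T.dist_nonneg w z
  rw [hxy.dist_eq, hxz.dist_eq, hyz.symm.dist_eq, T.dist_comm z w]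
  linarith

theorem Between.dist_add_dist_le (hx : T.Between x w a) (hy : T.Between y w a)
    (hz : T.Between y w z) : T.dist x z + T.dist a y ≤ T.dist y z + T.dist a x := by
  have := dist_triangle x w z
  rw [T.dist_comm a y, T.dist_comm a x, hx.dist_eq, hy.dist_eq, hz.dist_eq]
  linarith

theorem dist_four_point (a x y z : T.Node) :
    T.dist x z + T.dist a y ≤ max (T.dist x y + T.dist a z) (T.dist y z + T.dist a x) := by
  obtain ⟨c, hxcy, hxca, hyca⟩ := exists_median x y a
  obtain ⟨d, hydz, hyda, hzda⟩ := exists_median y z a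
  rcases hyca.total hyda with hcda | hdca
  · exact le_max_of_le_right ((hxca.trans_right hcda).dist_add_dist_le hyda hydz)
  · have := (hzda.trans_right hdca).dist_add_dist_le hyca hxcy.symm
    rw [T.dist_comm z x, T.dist_comm y x] at this
    exact le_max_of_le_left this

end WeightedTree

section

variable {n : ℕ} {M : Mat n}

theorem IsTreeMetric.diag (h : IsTreeMetric M) (u : Fin n) : M u u = 0 := by
  obtain ⟨T, f, h⟩ := h
  rw [h, T.dist_self]

theorem IsTreeMetric.symm (h : IsTreeMetric M) (u v : Fin n) : M u v = M v u := by
  obtain ⟨T, f, h⟩ := h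
  rw [h, h, T.dist_comm]

theorem IsTreeMetric.triangle (h : IsTreeMetric M) (u v w : Fin n) : M u w ≤ M u v + M v w := by
  obtain ⟨T, f, h⟩ := h
  simpa only [h] using WeightedTree.dist_triangle _ _ _

theorem IsTreeMetric.four_point (h : IsTreeMetric M) (a u v w : Fin n) :
    M u w + M a v ≤ max (M u v + M a w) (M v w + M a u) := by
  obtain ⟨T, f, h⟩ := h
  simpa only [h] using WeightedTree.dist_four_point _ _ _ _

theorem IsUltrametric.isTreeMetric (h : IsUltrametric M) : IsTreeMetric M := by
  obtain ⟨T, f, _, _, _, h⟩ := h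
  exact ⟨T, f, h⟩

theorem IsUltrametric.strong_triangle (h : IsUltrametric M) (u v w : Fin n) :
    M u w ≤ max (M u v) (M v w) := by
  obtain ⟨T, f, r, d, hd, h⟩ := h
  have := WeightedTree.dist_four_point r (f u) (f v) (f w)
  simpa only [hd, ← h, max_add_add_right, add_le_add_iff_right] using this

end

/-! ### Trees given by parent pointers -/

/-- A finite rooted tree presented by parent pointers and drawn in the plane so that no node lies
above its parent; the edge lengths are the differences of the heights.  The root is its own parent,
and `depth` makes every pointer chain end at the root. -/
structure ParentTree where
  Node : Type
  finite : Finite Node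
  root : Node
  parent : Node → Node
  depth : Node → ℕ
  height : Node → ℝ
  parent_root : parent root = root
  depth_parent_lt : ∀ x, x ≠ root → depth (parent x) < depth x
  height_le_parent : ∀ x, height x ≤ height (parent x)

namespace ParentTree

open Function

variable (P : ParentTree)

/-- The graph in which every node is joined to its parent. -/
def graph : SimpleGraph P.Node :=
  SimpleGraph.fromRel fun x y => P.parent x = y

variable {P} {x y : P.Node}

theorem adj_parent (hx : x ≠ P.root) : P.graph.Adj x (P.parent x) :=
  ⟨fun h => (P.depth_parent_lt x hx).ne (congrArg P.depth h.symm), .inl rfl⟩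

theorem depth_iterate_parent_le (x : P.Node) (k : ℕ) : P.depth (P.parent^[k] x) ≤ P.depth x := by
  induction k generalizing x with
  | zero => rfl
  | succ k ih =>
    rw [iterate_succ_apply]
    refine (ih _).trans ?_
    rcases eq_or_ne x P.root with rfl | hx
    · rw [P.parent_root]
    · exact (P.depth_parent_lt x hx).le

theorem exists_isPath_root (x : P.Node) : ∃ w : P.graph.Walk x P.root,
    w.IsPath ∧ ∀ z, z ∈ w.support ↔ ∃ k, P.parent^[k] x = z := by
  induction hd : P.depth x using Nat.strong_induction_on generalizing x with
  | _ d ih =>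
  subst hd
  rcases eq_or_ne x P.root with rfl | hx
  · exact ⟨.nil, .nil, fun z => by simp [iterate_fixed P.parent_root, eq_comm]⟩
  · obtain ⟨w, hw, hsupp⟩ := ih _ (P.depth_parent_lt x hx) (P.parent x) rfl
    refine ⟨.cons (adj_parent hx) w, hw.cons fun hmem => ?_, fun z => ?_⟩
    · obtain ⟨k, hk⟩ := (hsupp x).mp hmem
      have := depth_iterate_parent_le (P.parent x) k
      rw [hk] at this
      exact this.not_gt (P.depth_parent_lt x hx)
    · rw [SimpleGraph.Walk.support_cons, List.mem_cons, hsupp]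
      constructor
      · rintro (rfl | ⟨k, rfl⟩)
        exacts [⟨0, rfl⟩, ⟨k + 1, rfl⟩]
      · rintro ⟨_ | k, rfl⟩
        exacts [.inl rfl, .inr ⟨k, rfl⟩]

variable (P)

theorem card_edgeSet_graph_lt : Nat.card P.graph.edgeSet < Nat.card P.Node := by
  have := P.finite
  let edge : {x // x ≠ P.root} → P.graph.edgeSet := fun x =>
    ⟨s(x.1, P.parent x.1), adj_parent x.2⟩
  have hedge : Surjective edge := by
    rintro ⟨e, he⟩
    induction e with
    | _ x y =>
    obtain ⟨hne, rfl | rfl⟩ := (SimpleGraph.fromRel_adj ..).mp (P.graph.mem_edgeSet.mp he)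
    · exact ⟨⟨x, by rintro rfl; exact hne P.parent_root.symm⟩, rfl⟩
    · exact ⟨⟨y, by rintro rfl; exact hne P.parent_root⟩, Subtype.ext Sym2.eq_swap⟩
  exact (Nat.card_le_card_of_surjective edge hedge).trans_lt
    (Finite.card_subtype_lt (not_not_intro rfl))

theorem isTree_graph : P.graph.IsTree := by
  have := P.finite
  have hconn : P.graph.Connected := P.graph.connected_iff_exists_forall_reachable.mpr
    ⟨P.root, fun x => (exists_isPath_root x).choose.reachable.symm⟩
  exact SimpleGraph.isTree_iff_connected_and_card.mpr
    ⟨hconn, (Nat.succ_le_of_lt P.card_edgeSet_graph_lt).antisymm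
      hconn.card_vert_le_card_edgeSet_add_one⟩

/-- The weighted tree presented by the parent pointers. -/
noncomputable abbrev toWeightedTree : WeightedTree where
  Node := P.Node
  finite := P.finite
  graph := P.graph
  isTree := P.isTree_graph
  length := Sym2.lift ⟨fun x y => Real.nnabs (P.height x - P.height y), fun x y => by
    ext
    simp [abs_sub_comm]⟩

variable {P}

theorem between_root_iff {z : P.Node} :
    P.toWeightedTree.Between x z P.root ↔ ∃ k, P.parent^[k] x = z := by
  obtain ⟨w, hw, hsupp⟩ := exists_isPath_root x
  rw [← hsupp]
  exact ⟨fun h => h.mem_support hw, fun h => WeightedTree.between_of_mem_support hw h⟩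

theorem dist_parent (x : P.Node) :
    P.toWeightedTree.dist x (P.parent x) = P.height (P.parent x) - P.height x := by
  rcases eq_or_ne x P.root with rfl | hx
  · rw [P.parent_root, sub_self]
    exact P.toWeightedTree.dist_self P.root
  · rw [P.toWeightedTree.dist_of_adj (adj_parent hx)]
    simp [abs_sub_comm (P.height x), P.height_le_parent x]

theorem dist_root (x : P.Node) :
    P.toWeightedTree.dist x P.root = P.height P.root - P.height x := by
  induction hd : P.depth x using Nat.strong_induction_on generalizing x with
  | _ d ih =>
  subst hd
  rcases eq_or_ne x P.root with rfl | hx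
  · rw [sub_self]
    exact P.toWeightedTree.dist_self P.root
  · have hbetween : P.toWeightedTree.Between x (P.parent x) P.root := between_root_iff.mpr ⟨1, rfl⟩
    rw [hbetween.dist_eq, dist_parent, ih _ (P.depth_parent_lt x hx) _ rfl]
    ring

theorem dist_iterate_parent (x : P.Node) (k : ℕ) :
    P.toWeightedTree.dist x (P.parent^[k] x) = P.height (P.parent^[k] x) - P.height x := by
  have hbetween : P.toWeightedTree.Between x (P.parent^[k] x) P.root :=
    between_root_iff.mpr ⟨k, rfl⟩
  have := hbetween.dist_eq
  rw [dist_root, dist_root] at this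
  linarith

theorem dist_le {i j : ℕ} (h : P.parent^[i] x = P.parent^[j] y) :
    P.toWeightedTree.dist x y ≤ 2 * P.height (P.parent^[i] x) - P.height x - P.height y := by
  have htri := P.toWeightedTree.dist_triangle x (P.parent^[i] x) y
  have hx := dist_iterate_parent x i
  have hy := dist_iterate_parent y j
  rw [← h, P.toWeightedTree.dist_comm] at hy
  linarith

theorem exists_dist_eq (x y : P.Node) : ∃ i j, P.parent^[i] x = P.parent^[j] y ∧
    P.toWeightedTree.dist x y = 2 * P.height (P.parent^[i] x) - P.height x - P.height y := by
  obtain ⟨z, hxy, hx, hy⟩ := WeightedTree.exists_median (T := P.toWeightedTree) x y P.root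
  obtain ⟨i, rfl⟩ := between_root_iff.mp hx
  obtain ⟨j, hj⟩ := between_root_iff.mp hy
  have hdx := dist_iterate_parent x i
  have hdy := dist_iterate_parent y j
  rw [hj, P.toWeightedTree.dist_comm] at hdy
  refine ⟨i, j, hj.symm, ?_⟩
  rw [hxy.dist_eq]
  linarith

end ParentTree

/-! ### Realizing strong-triangle matrices by trees -/

theorem exists_monotone_enum {α : Type*} [LinearOrder α] [Nonempty α] (H : Finset α) :
    ∃ (N : ℕ) (η : ℕ → α), Monotone η ∧ ∀ a ∈ H, ∃ i ≤ N, η i = a := by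
  rcases H.eq_empty_or_nonempty with rfl | hne
  · exact ⟨0, fun _ => Classical.arbitrary α, monotone_const, by simp⟩
  obtain ⟨m, hm⟩ := Nat.exists_eq_succ_of_ne_zero hne.card_pos.ne'
  refine ⟨m, fun i => H.orderEmbOfFin hm (Fin.clamp i m), fun i j hij => ?_, fun a ha => ?_⟩
  · exact (H.orderEmbOfFin hm).monotone (Fin.mk_le_mk.mpr (min_le_min_right m hij))
  · obtain ⟨i, rfl⟩ : a ∈ Set.range (H.orderEmbOfFin hm) := by simpa using ha
    exact ⟨i, i.is_le, congrArg _ (Fin.ext (min_eq_left i.is_le))⟩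

section LevelTree

variable {ι : Type} (U : ι → ι → ℝ)

/-- The cluster of `u` at height `a`.  In a tree with leaf distances `U`, two leaves at height `0`
meet at half their distance, hence the factor `2`. -/
def cluster (a : ℝ) (u : ι) : Set ι :=
  {v | u = v ∨ U u v ≤ 2 * a}

/-- The union of the clusters at height `a` of the members of `C`: the parent of a cluster `C` in
the cluster tree. -/
def clusterHull (a : ℝ) (C : Set ι) : Set ι :=
  {v | ∃ u ∈ C, v ∈ cluster U a u}

variable {U}

theorem clusterHull_cluster (htri : ∀ u v w, U u w ≤ max (U u v) (U v w)) {a b : ℝ} (hab : a ≤ b)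
    (u : ι) : clusterHull U b (cluster U a u) = cluster U b u := by
  ext v
  refine ⟨?_, fun hv => ⟨u, .inl rfl, hv⟩⟩
  rintro ⟨w, rfl | huw, hv⟩
  · exact hv
  · have huw' : U u w ≤ 2 * b := huw.trans (by linarith)
    rcases hv with rfl | hwv
    exacts [.inr huw', .inr ((htri u w v).trans (max_le huw' hwv))]

theorem cluster_eq_of_le (hsymm : ∀ u v, U u v = U v u)
    (htri : ∀ u v w, U u w ≤ max (U u v) (U v w)) {a : ℝ} {u v : ι} (h : U u v ≤ 2 * a) :
    cluster U a u = cluster U a v := by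
  have hsub : ∀ {u v}, U u v ≤ 2 * a → cluster U a u ⊆ cluster U a v := by
    rintro u v h w (rfl | hw)
    · exact .inr (hsymm _ _ ▸ h)
    · exact .inr ((htri v u w).trans (max_le (hsymm u v ▸ h) hw))
  exact (hsub h).antisymm (hsub (hsymm u v ▸ h))

/-- The set `C` as a node of the level tree at level `i`; all sets at level `N` or above are the
root `none`. -/
def atLevel (N : ℕ) (C : Set ι) (i : ℕ) : Option (Set ι × Fin N) :=
  if h : i < N then some (C, ⟨i, h⟩) else none

/-- The level of a node of the level tree. -/
def nodeLevel {N : ℕ} : Option (Set ι × Fin N) → ℕ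
  | none => N
  | some (_, i) => i

variable {N : ℕ}

theorem nodeLevel_atLevel (C : Set ι) (i : ℕ) : nodeLevel (atLevel N C i) = min i N := by
  unfold atLevel
  split_ifs <;> simp only [nodeLevel] <;> omega

/-- The parent map of the level tree, whose level `i` consists of sets of elements drawn at height
`η i`. -/
def levelParent (U : ι → ι → ℝ) (η : ℕ → ℝ) :
    Option (Set ι × Fin N) → Option (Set ι × Fin N)
  | none => none
  | some (C, i) => atLevel N (clusterHull U (η (i + 1)) C) (i + 1)

theorem nodeLevel_levelParent (η : ℕ → ℝ) (x : Option (Set ι × Fin N)) :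
    nodeLevel (levelParent U η x) = min (nodeLevel x + 1) N := by
  match x with
  | none => simp [levelParent, nodeLevel]
  | some (C, i) => exact nodeLevel_atLevel _ _

/-- The tree of all clusters of `U` at the heights `η 0 ≤ ⋯ ≤ η N`.  Sets that are not clusters are
harmless further nodes. -/
noncomputable abbrev levelTree [Finite ι] (U : ι → ι → ℝ) (N : ℕ) {η : ℕ → ℝ} (hη : Monotone η) :
    ParentTree where
  Node := Option (Set ι × Fin N)
  finite := inferInstance
  root := none
  parent := levelParent U η
  depth x := N - nodeLevel x
  height x := η (nodeLevel x)
  parent_root := rfl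
  depth_parent_lt
    | none, h => absurd rfl h
    | some (C, i), _ => by
      have := i.is_lt
      rw [nodeLevel_levelParent, nodeLevel]
      omega
  height_le_parent x := hη <| by
    rw [nodeLevel_levelParent]
    match x with
    | none => simp [nodeLevel]
    | some (C, i) =>
      have := i.is_lt
      simp only [nodeLevel]
      omega

variable {η : ℕ → ℝ}

/-- The cluster of `u` at level `i`, as a node of the level tree. -/
def clusterNode (U : ι → ι → ℝ) (N : ℕ) (η : ℕ → ℝ) (u : ι) (i : ℕ) : Option (Set ι × Fin N) :=
  atLevel N (cluster U (η i) u) i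

theorem nodeLevel_clusterNode (u : ι) (i : ℕ) : nodeLevel (clusterNode U N η u i) = min i N :=
  nodeLevel_atLevel _ _

theorem clusterNode_eq_of_le (hsymm : ∀ u v, U u v = U v u)
    (htri : ∀ u v w, U u w ≤ max (U u v) (U v w)) {u v : ι} {i : ℕ} (h : U u v ≤ 2 * η i) :
    clusterNode U N η u i = clusterNode U N η v i := by
  rw [clusterNode, clusterNode, cluster_eq_of_le hsymm htri h]

theorem iterate_levelParent_clusterNode (htri : ∀ u v w, U u w ≤ max (U u v) (U v w))
    (hη : Monotone η) (u : ι) (i k : ℕ) :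
    (levelParent U η)^[k] (clusterNode U N η u i) = clusterNode U N η u (i + k) := by
  induction k with
  | zero => rfl
  | succ k ih =>
    rw [Function.iterate_succ_apply', ih, ← add_assoc]
    by_cases h : i + k < N
    · simp only [clusterNode, atLevel, h, dite_true, levelParent,
        clusterHull_cluster htri (hη (i + k).le_succ)]
    · simp only [clusterNode, atLevel, h, show ¬ i + k + 1 < N by omega, dite_false, levelParent]

theorem le_of_clusterNode_eq {u v : ι} (hN : U u v ≤ 2 * η N) (huv : u ≠ v) {i j : ℕ}
    (h : clusterNode U N η u i = clusterNode U N η v j) : U u v ≤ 2 * η (min i N) := by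
  rcases lt_or_ge i N with hi | hi
  · have hj : j < N := by
      have := congrArg nodeLevel h
      rw [nodeLevel_clusterNode, nodeLevel_clusterNode] at this
      omega
    simp only [clusterNode, atLevel, hi, hj, dite_true, Option.some.injEq, Prod.mk.injEq,
      Fin.mk.injEq] at h
    obtain ⟨hC, rfl⟩ := h
    have hv : v ∈ cluster U (η i) u := hC ▸ .inl rfl
    rw [min_eq_left hi.le]
    exact hv.resolve_left huv
  · rwa [min_eq_right hi]

variable [Finite ι]

theorem levelTree_dist_le (hsymm : ∀ u v, U u v = U v u)
    (htri : ∀ u v w, U u w ≤ max (U u v) (U v w)) (hη : Monotone η) {u v : ι} {i j k : ℕ}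
    (hik : i ≤ k) (hjk : j ≤ k) (hk : U u v ≤ 2 * η k) :
    (levelTree U N hη).toWeightedTree.dist (clusterNode U N η u i) (clusterNode U N η v j) ≤
      2 * η k - η (min i N) - η (min j N) := by
  have hu := iterate_levelParent_clusterNode (N := N) htri hη u i (k - i)
  have hv := iterate_levelParent_clusterNode (N := N) htri hη v j (k - j)
  rw [Nat.add_sub_cancel' hik] at hu
  rw [Nat.add_sub_cancel' hjk, ← clusterNode_eq_of_le hsymm htri hk] at hv
  have hdist := ParentTree.dist_le (P := levelTree U N hη) (hu.trans hv.symm)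
  simp only [hu, nodeLevel_clusterNode] at hdist
  exact hdist.trans (by gcongr; exact hη (min_le_left k N))

theorem le_levelTree_dist (htri : ∀ u v w, U u w ≤ max (U u v) (U v w)) (hη : Monotone η)
    {u v : ι} (hN : U u v ≤ 2 * η N) (huv : u ≠ v) (i j : ℕ) :
    U u v - η (min i N) - η (min j N) ≤
      (levelTree U N hη).toWeightedTree.dist (clusterNode U N η u i) (clusterNode U N η v j) := by
  obtain ⟨k, l, heq, hdist⟩ := ParentTree.exists_dist_eq (P := levelTree U N hη)
    (clusterNode U N η u i) (clusterNode U N η v j)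
  simp only [iterate_levelParent_clusterNode htri hη, nodeLevel_clusterNode] at heq hdist
  linarith [le_of_clusterNode_eq hN huv heq]

/-- The element `u` is drawn at height `c u`, below every branching above it. -/
theorem exists_tree_of_strong_triangle (hsymm : ∀ u v, U u v = U v u)
    (htri : ∀ u v w, U u w ≤ max (U u v) (U v w)) {c : ι → ℝ}
    (hc : ∀ u v, u ≠ v → 2 * c u ≤ U u v) :
    ∃ (T : WeightedTree) (node : ι → T.Node) (root : T.Node) (depth : ℝ),
      (∀ u, T.dist root (node u) = depth - c u) ∧
      ∀ u v, u ≠ v → T.dist (node u) (node v) = U u v - c u - c v := by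
  obtain ⟨N, η, hη, hH⟩ := exists_monotone_enum
    ((Set.finite_range c).union (Set.finite_range fun e : ι × ι => U e.1 e.2 / 2)).toFinset
  have hlevel : ∀ u, ∃ i ≤ N, η i = c u := fun u => hH _ (by simp)
  have hbranch : ∀ u v, ∃ i ≤ N, η i = U u v / 2 := fun u v => hH _ (by simp)
  choose l hlN hl using hlevel
  have hmin : ∀ u, η (min (l u) N) = c u := fun u => by rw [min_eq_left (hlN u), hl]
  refine ⟨(levelTree U N hη).toWeightedTree, fun u => clusterNode U N η u (l u), none, η N,
    fun u => ?_, fun u v huv => le_antisymm ?_ ?_⟩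
  · rw [← hmin, ← nodeLevel_clusterNode (U := U), WeightedTree.dist_comm]
    exact ParentTree.dist_root (P := levelTree U N hη) _
  · obtain ⟨k, -, hk⟩ := hbranch u v
    have hmax : 2 * η (max k (max (l u) (l v))) = U u v := by
      have hu := hc u v huv
      have hv := hc v u huv.symm
      rw [hsymm] at hv
      rw [hη.map_max, hη.map_max, hk, hl, hl, max_eq_left (max_le (by linarith) (by linarith))]
      ring
    have := levelTree_dist_le (N := N) hsymm htri hη ((le_max_left _ _).trans (le_max_right _ _))
      ((le_max_right _ _).trans (le_max_right _ _)) hmax.ge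
    rwa [hmin, hmin, hmax] at this
  · obtain ⟨k, hkN, hk⟩ := hbranch u v
    have hN : U u v ≤ 2 * η N := by linarith [hη hkN]
    have := le_levelTree_dist htri hη hN huv (l u) (l v)
    rwa [hmin, hmin] at this

end LevelTree

section

variable {n : ℕ} {U M : Mat n}

theorem isUltrametric_of_strong_triangle (hU : IsDistanceMatrix U)
    (htri : ∀ u v w, U u w ≤ max (U u v) (U v w)) : IsUltrametric U := by
  obtain ⟨T, node, root, depth, hroot, hdist⟩ := exists_tree_of_strong_triangle hU.symm htri
    (c := fun _ => 0) (fun u v _ => by simpa using hU.nonneg u v)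
  refine ⟨T, node, root, depth, fun u => by simpa using hroot u, fun u v => ?_⟩
  rcases eq_or_ne u v with rfl | huv
  · rw [hU.diag, T.dist_self]
  · simpa using (hdist u v huv).symm

theorem isTreeMetric_of_strong_triangle (hsymm : ∀ u v, U u v = U v u)
    (htri : ∀ u v w, U u w ≤ max (U u v) (U v w)) {c : Fin n → ℝ}
    (hc : ∀ u v, u ≠ v → 2 * c u ≤ U u v) (hdiag : ∀ u, M u u = 0)
    (hM : ∀ u v, u ≠ v → M u v = U u v - c u - c v) : IsTreeMetric M := by
  obtain ⟨T, node, root, depth, -, hdist⟩ := exists_tree_of_strong_triangle hsymm htri hc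
  refine ⟨T, node, fun u v => ?_⟩
  rcases eq_or_ne u v with rfl | huv
  · rw [hdiag, T.dist_self]
  · rw [hM u v huv, hdist u v huv]

end

/-! ### The reduction for a fixed pivot -/

/-- The real number closest to `x` among the third sides of triangles with sides `p` and `q`. -/
noncomputable def triangleClamp (p q x : ℝ) : ℝ :=
  max (p - q) (max (q - p) (min (p + q) x))

theorem triangleClamp_comm (p q x : ℝ) : triangleClamp p q x = triangleClamp q p x := by
  rw [triangleClamp, triangleClamp, max_left_comm, add_comm p]

theorem triangleClamp_eq_self {p q x : ℝ} (hp : p ≤ q + x) (hq : q ≤ p + x) (hx : x ≤ p + q) :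
    triangleClamp p q x = x := by
  rw [triangleClamp, min_eq_right hx, max_eq_right (sub_le_iff_le_add'.mpr hq),
    max_eq_right (sub_le_iff_le_add'.mpr hp)]

section Pivot

variable {n : ℕ}

/-- An upper bound for the distances from the pivot `a`. -/
noncomputable def radius (D : Mat n) (a : Fin n) : ℝ :=
  ∑ u, D a u

/-- The shift of the Farris transform with respect to the pivot `a`, which adds `slack D a u v` to
the distance of `u` and `v`: all elements move to distance `radius D a` from `a`. -/
noncomputable def slack (D : Mat n) (a u v : Fin n) : ℝ :=
  2 * radius D a - D a u - D a v

/-- The instance of ultrametric fitting for the pivot `a`: the Farris transform of the input, after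
clamping to the triangle inequalities with `a`. -/
noncomputable def pivotQuery (D : Mat n) (a : Fin n) : Mat n := fun u v =>
  if u = v then 0 else triangleClamp (D a u) (D a v) (D u v) + slack D a u v

/-- The tree metric obtained for the pivot `a` from the ultrametric `R`, by inverting the Farris
transform and clamping. -/
noncomputable def pivotTree (D : Mat n) (a : Fin n) (R : Mat n) : Mat n := fun u v =>
  if u = v then 0 else triangleClamp (D a u) (D a v) (R u v - slack D a u v)

variable {D T R : Mat n} {a u v : Fin n}

theorem le_radius (hD : IsDistanceMatrix D) (a u : Fin n) : D a u ≤ radius D a :=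
  Finset.single_le_sum (fun u _ => hD.nonneg a u) (Finset.mem_univ u)

theorem radius_nonneg (hD : IsDistanceMatrix D) (a : Fin n) : 0 ≤ radius D a :=
  Finset.sum_nonneg fun u _ => hD.nonneg a u

theorem slack_comm (D : Mat n) (a u v : Fin n) : slack D a u v = slack D a v u :=
  sub_right_comm _ _ _

theorem isDistanceMatrix_pivotQuery (hD : IsDistanceMatrix D) (a : Fin n) :
    IsDistanceMatrix (pivotQuery D a) where
  diag u := if_pos rfl
  symm u v := by
    simp only [pivotQuery, eq_comm (a := u), triangleClamp_comm (D a u), hD.symm u v,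
      slack_comm D a u]
  nonneg u v := by
    unfold pivotQuery
    split_ifs
    · exact le_rfl
    · have hclamp : D a u - D a v ≤ triangleClamp (D a u) (D a v) (D u v) := le_max_left _ _
      have hrad := le_radius hD a v
      unfold slack
      linarith

theorem isTreeMetric_pivotTree (D : Mat n) (a : Fin n) (hR : IsUltrametric R) :
    IsTreeMetric (pivotTree D a R) := by
  let c : Fin n → ℝ := fun u => radius D a - D a u
  -- clamping after the inverse transform is clamping `R` from above, and from below by `2 * c`
  let U : Mat n := fun u v => max (2 * c u) (max (2 * c v) (min (2 * radius D a) (R u v)))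
  have hsymm : ∀ u v, U u v = U v u := fun u v => by
    simp only [U, max_left_comm (2 * c u), hR.isTreeMetric.symm u v]
  have htri : ∀ u v w, U u w ≤ max (U u v) (U v w) := fun u v w => by
    have hmin : min (2 * radius D a) (R u w) ≤
        max (min (2 * radius D a) (R u v)) (min (2 * radius D a) (R v w)) := by
      rw [← min_max_distrib_left]
      exact min_le_min_left _ (hR.strong_triangle u v w)
    simp only [U]
    grind
  refine isTreeMetric_of_strong_triangle hsymm htri (c := c) (fun u v _ => le_max_left _ _)
    (fun u => if_pos rfl) (fun u v huv => ?_)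
  simp only [pivotTree, if_neg huv, triangleClamp, slack, U, c, ← max_sub_sub_right,
    ← min_sub_sub_right, max_left_comm (D a u - D a v)]
  congr 1 <;> [ring; congr 1 <;> [ring; congr 1 <;> ring]]

/-- The witness that the query of the pivot `a` has a good solution: the Farris transform of the
tree metric `T` on the pairs of elements whose distances from `a` are right in `T`, and the largest
possible value on all other pairs. -/
noncomputable def nearUltrametric (T D : Mat n) (a : Fin n) : Mat n :=
  open scoped Classical in fun u v =>
    if u = v then 0
    else if T a u = D a u ∧ T a v = D a v then T u v + slack D a u v
    else 2 * radius D a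

theorem nearUltrametric_of_eq (huv : u ≠ v) (h : T a u = D a u ∧ T a v = D a v) :
    nearUltrametric T D a u v = T u v + slack D a u v := by
  rw [nearUltrametric, if_neg huv, if_pos h]

theorem nearUltrametric_of_not_eq (huv : u ≠ v) (h : ¬ (T a u = D a u ∧ T a v = D a v)) :
    nearUltrametric T D a u v = 2 * radius D a := by
  rw [nearUltrametric, if_neg huv, if_neg h]

theorem nearUltrametric_le (hD : IsDistanceMatrix D) (hT : IsTreeMetric T) (a u v : Fin n) :
    nearUltrametric T D a u v ≤ 2 * radius D a := by
  unfold nearUltrametric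
  split_ifs with huv h
  · linarith [radius_nonneg hD a]
  · have := hT.triangle u a v
    rw [hT.symm u a] at this
    unfold slack
    linarith
  · exact le_rfl

theorem isDistanceMatrix_nearUltrametric (hD : IsDistanceMatrix D) (hT : IsTreeMetric T)
    (a : Fin n) : IsDistanceMatrix (nearUltrametric T D a) where
  diag u := if_pos rfl
  symm u v := by
    simp only [nearUltrametric, eq_comm (a := u), and_comm (a := T a u = _), hT.symm u v,
      slack_comm D a u]
  nonneg u v := by
    unfold nearUltrametric
    split_ifs with huv h
    · exact le_rfl
    · have := hT.triangle a v u
      have := le_radius hD a v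
      rw [hT.symm u v]
      unfold slack
      linarith
    · linarith [radius_nonneg hD a]

theorem isUltrametric_nearUltrametric (hD : IsDistanceMatrix D) (hT : IsTreeMetric T)
    (a : Fin n) : IsUltrametric (nearUltrametric T D a) := by
  have hS := isDistanceMatrix_nearUltrametric hD hT a
  have hle := nearUltrametric_le hD hT a
  refine isUltrametric_of_strong_triangle hS fun u v w => ?_
  rcases eq_or_ne u w with rfl | huw
  · rw [hS.diag]
    exact le_max_of_le_left (hS.nonneg _ _)
  rcases eq_or_ne u v with rfl | huv
  · exact le_max_right _ _
  rcases eq_or_ne v w with rfl | hvw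
  · exact le_max_left _ _
  by_cases huv' : T a u = D a u ∧ T a v = D a v; swap
  · exact le_max_of_le_left ((hle u w).trans_eq (nearUltrametric_of_not_eq huv huv').symm)
  by_cases hvw' : T a v = D a v ∧ T a w = D a w; swap
  · exact le_max_of_le_right ((hle u w).trans_eq (nearUltrametric_of_not_eq hvw hvw').symm)
  rw [nearUltrametric_of_eq huw ⟨huv'.1, hvw'.2⟩, nearUltrametric_of_eq huv huv',
    nearUltrametric_of_eq hvw hvw']
  -- the Farris transform turns the four-point condition at `a` into the strong triangle inequality
  have hfour := hT.four_point a u v w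
  simp only [slack]
  rcases le_max_iff.mp hfour with h | h
  · exact le_max_of_le_left (by linarith)
  · exact le_max_of_le_right (by linarith)

/-! ### Counting disagreements -/

open scoped Classical in
/-- The pairs on which the input and the tree metric `T` disagree, or one of whose elements has the
wrong distance from `a` in `T`. -/
noncomputable def badPairs (T D : Mat n) (a : Fin n) : Finset (Fin n × Fin n) :=
  {p | p.1 < p.2 ∧ (T p.1 p.2 ≠ D p.1 p.2 ∨ T a p.1 ≠ D a p.1 ∨ T a p.2 ≠ D a p.2)}

theorem eq_of_notMem_badPairs (huv : u < v) (h : (u, v) ∉ badPairs T D a) :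
    T u v = D u v ∧ T a u = D a u ∧ T a v = D a v := by
  simpa [badPairs, huv, not_or] using h

theorem triangleClamp_of_notMem_badPairs (hT : IsTreeMetric T) (huv : u < v)
    (h : (u, v) ∉ badPairs T D a) : triangleClamp (D a u) (D a v) (D u v) = D u v := by
  obtain ⟨huv, hu, hv⟩ := eq_of_notMem_badPairs huv h
  rw [← huv, ← hu, ← hv]
  refine triangleClamp_eq_self ?_ (hT.triangle a u v) ?_
  · rw [hT.symm u v]
    exact hT.triangle a v u
  · rw [hT.symm a u]
    exact hT.triangle u a v

theorem disagreements_nearUltrametric_le (hT : IsTreeMetric T) (D : Mat n) (a : Fin n) :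
    disagreements (nearUltrametric T D a) (pivotQuery D a) ≤ (badPairs T D a).card := by
  classical
  refine Finset.card_le_card ?_
  rintro ⟨u, v⟩ hp
  obtain ⟨huv, hne⟩ := (Finset.mem_filter.mp hp).2
  contrapose! hne
  obtain ⟨heq, hu, hv⟩ := eq_of_notMem_badPairs huv hne
  rw [nearUltrametric_of_eq huv.ne ⟨hu, hv⟩, pivotQuery, if_neg huv.ne,
    triangleClamp_of_notMem_badPairs hT huv hne, heq]

theorem disagreements_pivotTree_le (hT : IsTreeMetric T) (D : Mat n) (a : Fin n) (R : Mat n) :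
    disagreements (pivotTree D a R) D ≤
      disagreements R (pivotQuery D a) + (badPairs T D a).card := by
  classical
  refine (Finset.card_le_card ?_).trans (Finset.card_union_le _ _)
  rintro ⟨u, v⟩ hp
  obtain ⟨huv, hne⟩ := (Finset.mem_filter.mp hp).2
  contrapose! hne
  obtain ⟨hR, hgood⟩ := not_or.mp (mt Finset.mem_union.mpr hne)
  have hclamp := triangleClamp_of_notMem_badPairs hT huv hgood
  have hRuv : R u v = pivotQuery D a u v := by simpa [huv] using hR
  rw [pivotTree, if_neg huv.ne, hRuv, pivotQuery, if_neg huv.ne, hclamp, add_sub_cancel_right,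
    hclamp]

open scoped Classical in
theorem sum_card_ne_eq_two_mul_disagreements {A B : Mat n} (hA : ∀ u v, A u v = A v u)
    (hB : ∀ u v, B u v = B v u) (hdiag : ∀ u, A u u = B u u) :
    ∑ a, Finset.card {u | A a u ≠ B a u} = 2 * disagreements A B := by
  have hswap : Finset.card {p : Fin n × Fin n | p.2 < p.1 ∧ A p.1 p.2 ≠ B p.1 p.2} =
      disagreements A B :=
    Finset.card_equiv (Equiv.prodComm _ _) (by simp [hA, hB])
  calc ∑ a, Finset.card {u | A a u ≠ B a u}
      = Finset.card {p : Fin n × Fin n | A p.1 p.2 ≠ B p.1 p.2} := by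
        simp only [Finset.card_filter, Fintype.sum_prod_type]
    _ = disagreements A B +
          Finset.card {p : Fin n × Fin n | p.2 < p.1 ∧ A p.1 p.2 ≠ B p.1 p.2} := by
        rw [disagreements, ← Finset.card_union_of_disjoint
          (Finset.disjoint_filter.mpr fun p _ h h' => h.1.not_gt h'.1), ← Finset.filter_or]
        congr! 3 with p
        have : p.1 = p.2 → A p.1 p.2 = B p.1 p.2 := fun h => by rw [h, hdiag]
        grind
    _ = 2 * disagreements A B := by rw [hswap, two_mul]

open scoped Classical in
theorem card_badPairs_le (T D : Mat n) (a : Fin n) :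
    (badPairs T D a).card ≤ disagreements T D + Finset.card {u | T a u ≠ D a u} * n := by
  have hsub : badPairs T D a ⊆ ({p | p.1 < p.2 ∧ T p.1 p.2 ≠ D p.1 p.2} : Finset _) ∪
      (({u | T a u ≠ D a u} : Finset _) ×ˢ Finset.univ).image
        fun p => (min p.1 p.2, max p.1 p.2) := by
    rintro ⟨u, v⟩ hp
    obtain ⟨huv, h | h | h⟩ := (Finset.mem_filter.mp hp).2
    · exact Finset.mem_union_left _ (by simp [huv, h])
    · refine Finset.mem_union_right _ (Finset.mem_image.mpr ⟨(u, v), by simpa using h, ?_⟩)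
      rw [min_eq_left huv.le, max_eq_right huv.le]
    · refine Finset.mem_union_right _ (Finset.mem_image.mpr ⟨(v, u), by simpa using h, ?_⟩)
      rw [min_eq_right huv.le, max_eq_left huv.le]
  refine (Finset.card_le_card hsub).trans ((Finset.card_union_le _ _).trans ?_)
  exact Nat.add_le_add_left (Finset.card_image_le.trans_eq (by simp)) _

theorem sum_card_badPairs_le (hD : IsDistanceMatrix D) (hT : IsTreeMetric T) :
    ∑ a, (badPairs T D a).card ≤ n * (3 * disagreements T D) := by
  classical
  calc ∑ a, (badPairs T D a).card
      ≤ ∑ a, (disagreements T D + Finset.card {u | T a u ≠ D a u} * n) :=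
        Finset.sum_le_sum fun a _ => card_badPairs_le T D a
    _ = n * disagreements T D + (∑ a, Finset.card {u | T a u ≠ D a u}) * n := by
        simp only [Finset.sum_add_distrib, Finset.sum_const, Finset.card_univ, Fintype.card_fin,
          smul_eq_mul, Finset.sum_mul]
    _ = n * (3 * disagreements T D) := by
        rw [sum_card_ne_eq_two_mul_disagreements hT.symm hD.symm
          fun u => (hT.diag u).trans (hD.diag u).symm]
        ring

theorem exists_card_badPairs_le [NeZero n] (hD : IsDistanceMatrix D) (hT : IsTreeMetric T) :
    ∃ a, (badPairs T D a).card ≤ 3 * disagreements T D := by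
  have hsum : ∑ a, (badPairs T D a).card ≤ ∑ _a : Fin n, 3 * disagreements T D :=
    (sum_card_badPairs_le hD hT).trans_eq (by simp)
  obtain ⟨a, -, ha⟩ := Finset.exists_le_of_sum_le Finset.univ_nonempty hsum
  exact ⟨a, ha⟩

theorem exists_disagreements_pivotTree_le [NeZero n] (hD : IsDistanceMatrix D) {ρ : ℝ}
    (hρ : 0 ≤ ρ) {R : Fin n → Mat n}
    (hR : ∀ a, IsApproxSolution IsUltrametric ρ (pivotQuery D a) (R a)) (hT : IsTreeMetric T) :
    ∃ a, (disagreements (pivotTree D a (R a)) D : ℝ) ≤ 3 * (ρ + 1) * disagreements T D := by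
  obtain ⟨a, ha⟩ := exists_card_badPairs_le hD hT
  refine ⟨a, ?_⟩
  have hnear : (disagreements (nearUltrametric T D a) (pivotQuery D a) : ℝ) ≤
      (badPairs T D a).card := mod_cast disagreements_nearUltrametric_le hT D a
  calc (disagreements (pivotTree D a (R a)) D : ℝ)
      ≤ disagreements (R a) (pivotQuery D a) + (badPairs T D a).card :=
        mod_cast disagreements_pivotTree_le hT D a (R a)
    _ ≤ ρ * (badPairs T D a).card + (badPairs T D a).card := by
        gcongr
        exact ((hR a).2 _ (isUltrametric_nearUltrametric hD hT a)).trans (by gcongr)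
    _ = (ρ + 1) * (badPairs T D a).card := by ring
    _ ≤ (ρ + 1) * ((3 * disagreements T D : ℕ) : ℝ) := by gcongr
    _ = 3 * (ρ + 1) * disagreements T D := by push_cast; ring

end Pivot

/-! ### Programs with bounded cost -/

/-- With oracle `O`, program `p` takes memory `s` to memory `s'` in at most `B` steps. -/
def Runs (O : Oracle) (p : Prog) (s s' : Store) (B : ℕ) : Prop :=
  ∃ c ≤ B, Exec O p s s' c

namespace Runs

variable {O : Oracle} {p q : Prog} {b : BExp} {s s' s'' : Store} {B C : ℕ}

theorem mono (h : Runs O p s s' B) (hBC : B ≤ C) : Runs O p s s' C := by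
  obtain ⟨c, hc, h⟩ := h
  exact ⟨c, hc.trans hBC, h⟩

theorem nop (s : Store) : Runs O .nop s s 1 :=
  ⟨_, le_rfl, .nop s⟩

theorem setN (s : Store) (a : ℕ) (i e : NExp) :
    Runs O (.setN a i e) s (s.setInt a (i.eval s) (e.eval s)) (i.size + e.size + 1) :=
  ⟨_, le_rfl, .setN s a i e⟩

theorem setR (s : Store) (a : ℕ) (i j : NExp) (e : RExp) :
    Runs O (.setR a i j e) s (s.setReal a (i.eval s) (j.eval s) (e.eval s))
      (i.size + j.size + e.size + 1) :=
  ⟨_, le_rfl, .setR s a i j e⟩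

theorem seq (h : Runs O p s s' B) (h' : Runs O q s' s'' C) :
    Runs O (.seq p q) s s'' (B + C) := by
  obtain ⟨c, hc, h⟩ := h
  obtain ⟨d, hd, h'⟩ := h'
  exact ⟨c + d, add_le_add hc hd, .seq h h'⟩

theorem ite_true (hb : b.holds s) (h : Runs O p s s' B) :
    Runs O (.ite b p q) s s' (b.size + B) := by
  obtain ⟨c, hc, h⟩ := h
  exact ⟨_, Nat.add_le_add_left hc _, .ite_true hb h⟩

theorem ite_false (hb : ¬ b.holds s) (h : Runs O q s s' B) :
    Runs O (.ite b p q) s s' (b.size + B) := by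
  obtain ⟨c, hc, h⟩ := h
  exact ⟨_, Nat.add_le_add_left hc _, .ite_false hb h⟩

theorem loop_true (hb : b.holds s) (h : Runs O p s s' B) (h' : Runs O (.loop b p) s' s'' C) :
    Runs O (.loop b p) s s'' (b.size + B + C) := by
  obtain ⟨c, hc, h⟩ := h
  obtain ⟨d, hd, h'⟩ := h'
  exact ⟨_, add_le_add (Nat.add_le_add_left hc _) hd, .loop_true hb h h'⟩

theorem loop_false (hb : ¬ b.holds s) : Runs O (.loop b p) s s b.size :=
  ⟨_, le_rfl, .loop_false hb⟩

theorem oracle {k : NExp} {src dst n c : ℕ} {R : Mat n} (hk : k.eval s = n)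
    (h : O n (s.read src n) = some (R, c)) :
    Runs O (.oracle k src dst) s (s.write dst R) (k.size + 2 * n ^ 2 + c + 1) := by
  subst hk
  exact ⟨_, le_rfl, .oracle h⟩

end Runs

namespace Store

variable (s : Store)

@[simp] theorem setInt_int_self (a i x : ℕ) : (s.setInt a i x).int a i = x := by
  simp [setInt]

@[simp] theorem setReal_real_self (a i j : ℕ) (x : ℝ) : (s.setReal a i j x).real a i j = x := by
  simp [setReal]

theorem setReal_real_of_ne {a i j k l : ℕ} (h : (k, l) ≠ (i, j)) (x : ℝ) :
    (s.setReal a i j x).real a k l = s.real a k l :=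
  if_neg fun h' => h (by rw [h'.2.1, h'.2.2])

@[simp] theorem setReal_same (a i j : ℕ) : s.setReal a i j (s.real a i j) = s := by
  cases s
  simp only [setReal, mk.injEq, true_and]
  funext b k l
  grind

@[simp] theorem setReal_setReal (a i j : ℕ) (x y : ℝ) :
    (s.setReal a i j x).setReal a i j y = s.setReal a i j y := by
  simp only [setReal, mk.injEq, true_and]
  funext b k l
  split_ifs <;> rfl

@[simp] theorem read_write (a : ℕ) {n : ℕ} (M : Mat n) : (s.write a M).read a n = M := by
  funext u v
  simp [read, write]

/-- The frame condition of a program: the memories `s` and `s'` agree outside the integer arrays in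
`I` and the real arrays in `R`. -/
structure EqOff (I R : Finset ℕ) (s s' : Store) : Prop where
  int : ∀ a ∉ I, s'.int a = s.int a
  real : ∀ a ∉ R, s'.real a = s.real a

variable {s} {s' s'' : Store} {I R : Finset ℕ}

theorem EqOff.refl (I R : Finset ℕ) (s : Store) : EqOff I R s s :=
  ⟨fun _ _ => rfl, fun _ _ => rfl⟩

theorem EqOff.trans (h : EqOff I R s s') (h' : EqOff I R s' s'') : EqOff I R s s'' :=
  ⟨fun a ha => (h'.int a ha).trans (h.int a ha), fun a ha => (h'.real a ha).trans (h.real a ha)⟩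

theorem EqOff.mono {I' R' : Finset ℕ} (h : EqOff I R s s') (hI : I ⊆ I') (hR : R ⊆ R') :
    EqOff I' R' s s' :=
  ⟨fun a ha => h.int a (mt (@hI a) ha), fun a ha => h.real a (mt (@hR a) ha)⟩

theorem EqOff.read (h : EqOff I R s s') {a : ℕ} (ha : a ∉ R) (n : ℕ) :
    s'.read a n = s.read a n := by
  unfold Store.read
  rw [h.real a ha]

theorem eqOff_setInt {a : ℕ} (ha : a ∈ I) (R : Finset ℕ) (s : Store) (i x : ℕ) :
    EqOff I R s (s.setInt a i x) where
  int b hb := by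
    have hne : b ≠ a := fun h => hb (h ▸ ha)
    simp [setInt, hne]
  real _ _ := rfl

theorem eqOff_setReal {a : ℕ} (I : Finset ℕ) (ha : a ∈ R) (s : Store) (i j : ℕ) (x : ℝ) :
    EqOff I R s (s.setReal a i j x) where
  int _ _ := rfl
  real b hb := by
    have hne : b ≠ a := fun h => hb (h ▸ ha)
    simp [setReal, hne]

theorem eqOff_write {a n : ℕ} (I : Finset ℕ) (ha : a ∈ R) (s : Store) (M : Mat n) :
    EqOff I R s (s.write a M) where
  int _ _ := rfl
  real b hb := by
    have hne : b ≠ a := fun h => hb (h ▸ ha)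
    simp [write, hne]

end Store

/-! ### Memory layout -/

-- `sizeVar`, `inputArr` and `bestArr` are prescribed by `Store.init` and `Prog.Computes`.

abbrev sizeVar : ℕ := 0
abbrev rowVar : ℕ := 1
abbrev colVar : ℕ := 2
abbrev pivotVar : ℕ := 3
abbrev countVar : ℕ := 4
abbrev bestVar : ℕ := 5

abbrev inputArr : ℕ := 0
abbrev bestArr : ℕ := 1
abbrev queryArr : ℕ := 2
abbrev radiusArr : ℕ := 3
abbrev answerArr : ℕ := 4
abbrev treeArr : ℕ := 5

/-- The integer variable number `a`, kept in entry `0` of the array of that number. -/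
def nvar (a : ℕ) : NExp :=
  .cell a (.const 0)

@[simp] theorem eval_nvar (a : ℕ) (s : Store) : (nvar a).eval s = s.int a 0 := rfl

@[simp] theorem size_nvar (a : ℕ) : (nvar a).size = 2 := rfl

/-- The entry of real array `a` at the position of a grid loop. -/
def gridCell (a : ℕ) : RExp :=
  .cell a (nvar rowVar) (nvar colVar)

/-! ### Counting loops -/

/-- Run `p` with variable `v` ranging over the numbers below the input size. -/
def forLoop (v : ℕ) (p : Prog) : Prog :=
  .seq (.setN v (.const 0) (.const 0))
    (.loop (.leN (.add (nvar v) (.const 1)) (nvar sizeVar))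
      (.seq p (.setN v (.const 0) (.add (nvar v) (.const 1)))))

/-- Run `p` for all positions in an `n × n` matrix, where `n` is the input size. -/
def gridLoop (p : Prog) : Prog :=
  forLoop rowVar (forLoop colVar p)

/-- The cost of `forLoop v p`, as a polynomial in the input size, if `p` has cost `q`. -/
noncomputable def loopCost (q : Polynomial ℕ) : Polynomial ℕ :=
  .X * (q + 13) + 10

@[simp] theorem eval_loopCost (q : Polynomial ℕ) (n : ℕ) :
    (loopCost q).eval n = n * (q.eval n + 13) + 10 := by
  simp [loopCost]

/-- The cost of `gridLoop p`, as a polynomial in the input size, if `p` takes `B` steps. -/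
noncomputable def gridCost (B : ℕ) : Polynomial ℕ :=
  loopCost (loopCost (.C B))

section Loops

variable {O : Oracle} {p : Prog} {n B : ℕ} {s : Store}

theorem Runs.forLoop {v : ℕ} (Inv : Finset (Fin n) → Store → Prop)
    (size : ∀ S s, Inv S s → s.int sizeVar 0 = n)
    (stable : ∀ S s x, Inv S s → Inv S (s.setInt v 0 x))
    (step : ∀ (S : Finset (Fin n)) (i : Fin n), i ∉ S → ∀ s, Inv S s → s.int v 0 = i →
      ∃ s', Runs O p s s' B ∧ s'.int v 0 = i ∧ Inv (insert i S) s')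
    (start : Inv ∅ s) :
    ∃ s', Runs O (forLoop v p) s s' (n * (B + 13) + 10) ∧ Inv Finset.univ s' := by
  have iterate : ∀ m i s, i + m = n → Inv {j | j.1 < i} s → s.int v 0 = i →
      ∃ s', Runs O (.loop (.leN (.add (nvar v) (.const 1)) (nvar sizeVar))
        (.seq p (.setN v (.const 0) (.add (nvar v) (.const 1))))) s s' (m * (B + 13) + 7) ∧
        Inv Finset.univ s' := by
    intro m
    induction m with
    | zero =>
      rintro _ s rfl hs hv
      refine ⟨s, (Runs.loop_false ?_).mono (by simp [BExp.size, NExp.size]), by simpa using hs⟩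
      simp [BExp.holds, NExp.eval, size _ s hs, hv]
    | succ m ih =>
      intro i s hi hs hv
      obtain ⟨s₁, hrun, hv₁, hs₁⟩ := step _ ⟨i, by omega⟩ (by simp) s hs hv
      have hinsert : insert ⟨i, by omega⟩ ({j | j.1 < i} : Finset (Fin n)) =
          ({j | j.1 < i + 1} : Finset (Fin n)) := by
        ext j
        simp only [Finset.mem_insert, Finset.mem_filter_univ, Fin.ext_iff]
        omega
      rw [hinsert] at hs₁
      obtain ⟨s₂, hrun', hs₂⟩ := ih (i + 1) (s₁.setInt v 0 (i + 1)) (by omega)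
        (stable _ _ _ hs₁) (by simp)
      have hnext := Runs.setN (O := O) s₁ v (.const 0) (.add (nvar v) (.const 1))
      simp only [NExp.eval, eval_nvar, hv₁] at hnext
      refine ⟨s₂, (Runs.loop_true ?_ (hrun.seq hnext) hrun').mono ?_, hs₂⟩
      · simp only [BExp.holds, NExp.eval, size _ s hs, eval_nvar, hv]
        omega
      · simp only [BExp.size, NExp.size, size_nvar]
        ring_nf
        omega
  obtain ⟨s', hrun, hs'⟩ := iterate n 0 (s.setInt v 0 0) (by omega)
    (by simpa using stable _ _ 0 start) (by simp)
  refine ⟨s', (Runs.seq (Runs.setN s v (.const 0) (.const 0)) hrun).mono ?_, hs'⟩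
  simp only [NExp.size]
  omega

theorem Runs.gridLoop (Inv : Finset (Fin n × Fin n) → Store → Prop)
    (size : ∀ S s, Inv S s → s.int sizeVar 0 = n)
    (setRow : ∀ S s x, Inv S s → Inv S (s.setInt rowVar 0 x))
    (setCol : ∀ S s x, Inv S s → Inv S (s.setInt colVar 0 x))
    (step : ∀ (S : Finset (Fin n × Fin n)) (u v : Fin n), (u, v) ∉ S → ∀ s, Inv S s →
      s.int rowVar 0 = u → s.int colVar 0 = v →
      ∃ s', Runs O p s s' B ∧ s'.int rowVar 0 = u ∧ s'.int colVar 0 = v ∧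
        Inv (insert (u, v) S) s')
    (start : Inv ∅ s) :
    ∃ s', Runs O (gridLoop p) s s' ((gridCost B).eval n) ∧ Inv Finset.univ s' := by
  have row : ∀ (S : Finset (Fin n)) u, u ∉ S → ∀ s, Inv (S ×ˢ Finset.univ) s →
      s.int rowVar 0 = u → ∃ s', Runs O (L0Fit.forLoop colVar p) s s' (n * (B + 13) + 10) ∧
        s'.int rowVar 0 = u ∧ Inv (insert u S ×ˢ Finset.univ) s' := by
    intro S u hu s hs hrow
    obtain ⟨s', hrun, hs', hrow'⟩ := Runs.forLoop (O := O) (p := p) (B := B) (v := colVar) (s := s)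
      (fun S' s => Inv (S ×ˢ Finset.univ ∪ {u} ×ˢ S') s ∧ s.int rowVar 0 = u)
      (fun _ s hs => size _ s hs.1) (fun _ s x hs => ⟨setCol _ s x hs.1, hs.2⟩)
      (fun S' v hv s hs hcol => by
        obtain ⟨s', hrun, hrow', hcol', hs'⟩ := step _ u v (by simp [hu, hv]) s hs.1 hs.2 hcol
        refine ⟨s', hrun, hcol', ?_, hrow'⟩
        rwa [Finset.singleton_product, Finset.map_insert, Finset.union_insert,
          ← Finset.singleton_product])
      ⟨by simpa using hs, hrow⟩
    refine ⟨s', hrun, hrow', ?_⟩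
    rwa [Finset.insert_eq, Finset.union_product, Finset.union_comm]
  obtain ⟨s', hrun, hs'⟩ := Runs.forLoop (fun S s => Inv (S ×ˢ Finset.univ) s)
    (fun _ s hs => size _ s hs) (fun _ s x hs => setRow _ s x hs) row (by simpa using start)
  exact ⟨s', by simpa [gridCost, L0Fit.gridLoop] using hrun, by simpa using hs'⟩

theorem Runs.fill {d : ℕ} (f : Mat n) (hn : s.int sizeVar 0 = n)
    (hp : ∀ (s₁ : Store) (u v : Fin n), s.EqOff {rowVar, colVar} {d} s₁ →
      s₁.int rowVar 0 = u → s₁.int colVar 0 = v → Runs O p s₁ (s₁.setReal d u v (f u v)) B) :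
    ∃ s', Runs O (L0Fit.gridLoop p) s s' ((gridCost B).eval n) ∧
      s.EqOff {rowVar, colVar} {d} s' ∧ s'.read d n = f := by
  obtain ⟨s', hrun, hframe, hs'⟩ := Runs.gridLoop (O := O) (p := p) (B := B) (s := s)
    (fun S s' => s.EqOff {rowVar, colVar} {d} s' ∧
      ∀ uv ∈ S, s'.real d uv.1 uv.2 = f uv.1 uv.2)
    (fun _ s' h => by rw [h.1.int _ (by decide), hn])
    (fun _ s' x h => ⟨h.1.trans (Store.eqOff_setInt (by decide) _ _ _ _), h.2⟩)
    (fun _ s' x h => ⟨h.1.trans (Store.eqOff_setInt (by decide) _ _ _ _), h.2⟩)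
    (fun S u v _ s₁ h hu hv => by
      refine ⟨_, hp s₁ u v h.1 hu hv, hu, hv,
        h.1.trans (Store.eqOff_setReal _ (Finset.mem_singleton_self d) _ _ _ _), ?_⟩
      rintro ⟨u', v'⟩ huv
      by_cases heq : (u', v') = (u, v)
      · rw [(Prod.mk.inj heq).1, (Prod.mk.inj heq).2, Store.setReal_real_self]
      · rw [Store.setReal_real_of_ne]
        · exact h.2 _ (Finset.mem_of_mem_insert_of_ne huv heq)
        · simpa [Fin.ext_iff] using heq)
    ⟨.refl _ _ _, by simp⟩
  exact ⟨s', hrun, hframe, funext₂ fun u v => hs' (u, v) (Finset.mem_univ _)⟩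

end Loops

/-! ### The program -/

/-- The distance from the pivot to the element in integer variable `v`. -/
def pivotDist (v : ℕ) : RExp :=
  .cell inputArr (nvar pivotVar) (nvar v)

/-- The expression for `radius`, which is kept in entry `(0, 0)` of its array. -/
def radiusCell : RExp :=
  .cell radiusArr (.const 0) (.const 0)

/-- The expression for `slack` at the position of a grid loop. -/
def slackExp : RExp :=
  .sub (.sub (.add radiusCell radiusCell) (pivotDist rowVar)) (pivotDist colVar)

/-- Compute `radius`. -/
def radiusProg : Prog :=
  .seq (.setR radiusArr (.const 0) (.const 0) (.ofNat (.const 0)))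
    (forLoop colVar
      (.setR radiusArr (.const 0) (.const 0) (.add radiusCell (pivotDist colVar))))

/-- Assign `e` to the current cell of array `d`. -/
def assignProg (d : ℕ) (e : RExp) : Prog :=
  .setR d (nvar rowVar) (nvar colVar) e

/-- Replace the value `x` of the current cell of array `d` by `min e x`. -/
def minProg (d : ℕ) (e : RExp) : Prog :=
  .ite (.leR e (gridCell d)) (assignProg d e) .nop

/-- Replace the value `x` of the current cell of array `d` by `max e x`. -/
def maxProg (d : ℕ) (e : RExp) : Prog :=
  .ite (.leR (gridCell d) e) (assignProg d e) .nop

/-- Assign the `triangleClamp` of `e`, with respect to the distances from the pivot, to the current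
cell of array `d`. -/
def clampProg (d : ℕ) (e : RExp) : Prog :=
  .seq (assignProg d e)
    (.seq (minProg d (.add (pivotDist rowVar) (pivotDist colVar)))
      (.seq (maxProg d (.sub (pivotDist colVar) (pivotDist rowVar)))
        (maxProg d (.sub (pivotDist rowVar) (pivotDist colVar)))))

/-- Run `p` off the diagonal, and assign `0` to the current cell of array `d` on the diagonal. -/
def offDiagProg (d : ℕ) (p : Prog) : Prog :=
  .ite (.and (.leN (nvar rowVar) (nvar colVar)) (.leN (nvar colVar) (nvar rowVar)))
    (assignProg d (.ofNat (.const 0))) p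

/-- Compute `pivotQuery`. -/
def queryProg : Prog :=
  gridLoop (offDiagProg queryArr (.seq (clampProg queryArr (gridCell inputArr))
    (assignProg queryArr (.add (gridCell queryArr) slackExp))))

/-- Compute `pivotTree` from the answer of the oracle. -/
def treeProg : Prog :=
  gridLoop (offDiagProg treeArr (clampProg treeArr (.sub (gridCell answerArr) slackExp)))

/-- Count the disagreements of the current tree metric and the input. -/
def countProg : Prog :=
  .seq (.setN countVar (.const 0) (.const 0))
    (gridLoop
      (.ite (.and (.not (.leN (nvar colVar) (nvar rowVar)))
          (.not (.and (.leR (gridCell treeArr) (gridCell inputArr))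
            (.leR (gridCell inputArr) (gridCell treeArr)))))
        (.setN countVar (.const 0) (.add (nvar countVar) (.const 1))) .nop))

/-- Keep the current tree metric if it is the first one or better than those before.  The value of
`bestVar` is the smallest number of disagreements so far *plus one*, so that the initial value `0`
means that there is no tree metric yet. -/
def keepProg : Prog :=
  .ite (.and (.leN (.const 1) (nvar bestVar))
      (.leN (nvar bestVar) (.add (nvar countVar) (.const 1))))
    .nop
    (.seq (gridLoop (assignProg bestArr (gridCell treeArr)))
      (.setN bestVar (.const 0) (.add (nvar countVar) (.const 1))))

/-- Treat one pivot. -/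
def pivotProg : Prog :=
  .seq radiusProg (.seq queryProg (.seq (.oracle (nvar sizeVar) queryArr answerArr)
    (.seq treeProg (.seq countProg keepProg))))

/-- Fit a tree metric by ultrametrics: try all pivots and keep the best result. -/
def fitTreeProg : Prog :=
  forLoop pivotVar pivotProg

/-! ### Correctness of the program -/

/-- The memory holds the input `D` and the pivot `a`. -/
structure Store.HasPivot {n : ℕ} (D : Mat n) (a : Fin n) (s : Store) : Prop where
  size : s.int sizeVar 0 = n
  input : s.read inputArr n = D
  pivot : s.int pivotVar 0 = a

/-- Among the matrices `M a` with `a ∈ S`, the memory holds one with the fewest disagreements with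
`D`, in the encoding of `keepProg`. -/
def Store.HoldsBest {n : ℕ} (D : Mat n) (M : Fin n → Mat n) (S : Finset (Fin n)) (s : Store) :
    Prop :=
  (S = ∅ ∧ s.int bestVar 0 = 0) ∨
    ∃ a ∈ S, s.read bestArr n = M a ∧ s.int bestVar 0 = disagreements (M a) D + 1 ∧
      ∀ b ∈ S, disagreements (M a) D ≤ disagreements (M b) D

/-- The cost of `keepProg`, as a polynomial in the input size. -/
noncomputable def keepCost : Polynomial ℕ :=
  gridCost 10 + 20

/-- The cost of `pivotProg` without the time taken by the oracle, as a polynomial in the input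
size. -/
noncomputable def pivotCost : Polynomial ℕ :=
  .X * 25 + 15 + gridCost 160 + (2 * .X ^ 2 + 3) + gridCost 160 + (gridCost 40 + 3) + keepCost

section Correctness

variable {O : Oracle} {n : ℕ} {D : Mat n} {a u v : Fin n} {s : Store}

theorem Store.HasPivot.of_eqOff {I R : Finset ℕ} {s' : Store} (h : s.HasPivot D a)
    (hs : s.EqOff I R s') (hsize : sizeVar ∉ I := by decide) (hpivot : pivotVar ∉ I := by decide)
    (hinput : inputArr ∉ R := by decide) : s'.HasPivot D a where
  size := by rw [hs.int _ hsize, h.size]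
  input := by rw [hs.read hinput, h.input]
  pivot := by rw [hs.int _ hpivot, h.pivot]

theorem eval_pivotDist (h : s.HasPivot D a) {w : ℕ} (hu : s.int w 0 = u) :
    (pivotDist w).eval s = D a u := by
  simp only [pivotDist, RExp.eval, eval_nvar, h.pivot, hu, ← h.input, Store.read]

theorem eval_slackExp (h : s.HasPivot D a) (hr : s.real radiusArr 0 0 = radius D a)
    (hu : s.int rowVar 0 = u) (hv : s.int colVar 0 = v) :
    slackExp.eval s = slack D a u v := by
  simp only [slackExp, RExp.eval, eval_pivotDist h hu, eval_pivotDist h hv, radiusCell, NExp.eval,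
    hr, slack, two_mul]

theorem eval_gridCell {d : ℕ} {M : Mat n} (hM : s.read d n = M) (hu : s.int rowVar 0 = u)
    (hv : s.int colVar 0 = v) : (gridCell d).eval s = M u v := by
  simp only [gridCell, RExp.eval, eval_nvar, hu, hv, ← hM, Store.read]

theorem runs_radiusProg (h : s.HasPivot D a) :
    ∃ s', Runs O radiusProg s s' (n * 25 + 15) ∧ s.EqOff {colVar} {radiusArr} s' ∧
      s'.real radiusArr 0 0 = radius D a := by
  obtain ⟨s', hrun, hframe, hs'⟩ := Runs.forLoop (O := O) (v := colVar) (B := 12)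
    (p := .setR radiusArr (.const 0) (.const 0) (.add radiusCell (pivotDist colVar)))
    (s := s.setReal radiusArr 0 0 0)
    (fun S s' => s.EqOff {colVar} {radiusArr} s' ∧ s'.real radiusArr 0 0 = ∑ u ∈ S, D a u)
    (fun S s' hs' => (h.of_eqOff hs'.1).size)
    (fun S s' x hs' => ⟨hs'.1.trans (Store.eqOff_setInt (by decide) _ _ _ _), hs'.2⟩)
    (fun S u hu s₁ hs₁ hcol => by
      refine ⟨_, Runs.setR _ _ _ _ _, hcol,
        hs₁.1.trans (Store.eqOff_setReal _ (by decide) _ _ _ _), ?_⟩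
      simp only [NExp.eval, RExp.eval, radiusCell, eval_pivotDist (h.of_eqOff hs₁.1) hcol,
        Store.setReal_real_self, hs₁.2, Finset.sum_insert hu, add_comm])
    ⟨Store.eqOff_setReal _ (by decide) _ _ _ _, by simp⟩
  have hinit := Runs.setR (O := O) s radiusArr (.const 0) (.const 0) (.ofNat (.const 0))
  simp only [NExp.eval, RExp.eval, Nat.cast_zero] at hinit
  refine ⟨s', (hinit.seq hrun).mono ?_, hframe, hs'⟩
  simp only [NExp.size, RExp.size]
  omega

theorem runs_assignProg (hu : s.int rowVar 0 = u) (hv : s.int colVar 0 = v) (d : ℕ) (e : RExp) :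
    Runs O (assignProg d e) s (s.setReal d u v (e.eval s)) (e.size + 5) := by
  have hrun := Runs.setR (O := O) s d (nvar rowVar) (nvar colVar) e
  rw [eval_nvar, eval_nvar, hu, hv] at hrun
  exact hrun.mono (by simp only [size_nvar]; omega)

theorem runs_minProg (hu : s.int rowVar 0 = u) (hv : s.int colVar 0 = v) (d : ℕ) (e : RExp) :
    Runs O (minProg d e) s (s.setReal d u v (min (e.eval s) (s.real d u v)))
      (2 * e.size + 11) := by
  have htest : BExp.holds s (.leR e (gridCell d)) ↔ e.eval s ≤ s.real d u v := by
    rw [BExp.holds, eval_gridCell rfl hu hv, Store.read]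
  by_cases h : e.eval s ≤ s.real d u v
  · rw [min_eq_left h]
    refine (Runs.ite_true (htest.mpr h) (runs_assignProg hu hv d e)).mono ?_
    simp only [BExp.size, RExp.size, size_nvar, gridCell]
    omega
  · rw [min_eq_right (le_of_not_ge h), Store.setReal_same]
    refine (Runs.ite_false (mt htest.mp h) (Runs.nop _)).mono ?_
    simp only [BExp.size, RExp.size, size_nvar, gridCell]
    omega

theorem runs_maxProg (hu : s.int rowVar 0 = u) (hv : s.int colVar 0 = v) (d : ℕ) (e : RExp) :
    Runs O (maxProg d e) s (s.setReal d u v (max (e.eval s) (s.real d u v)))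
      (2 * e.size + 11) := by
  have htest : BExp.holds s (.leR (gridCell d) e) ↔ s.real d u v ≤ e.eval s := by
    rw [BExp.holds, eval_gridCell rfl hu hv, Store.read]
  by_cases h : s.real d u v ≤ e.eval s
  · rw [max_eq_left h]
    refine (Runs.ite_true (htest.mpr h) (runs_assignProg hu hv d e)).mono ?_
    simp only [BExp.size, RExp.size, size_nvar, gridCell]
    omega
  · rw [max_eq_right (le_of_not_ge h), Store.setReal_same]
    refine (Runs.ite_false (mt htest.mp h) (Runs.nop _)).mono ?_
    simp only [BExp.size, RExp.size, size_nvar, gridCell]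
    omega

theorem runs_clampProg (h : s.HasPivot D a) (hu : s.int rowVar 0 = u) (hv : s.int colVar 0 = v)
    {d : ℕ} (hd : d ≠ inputArr) (e : RExp) :
    Runs O (clampProg d e) s
      (s.setReal d u v (triangleClamp (D a u) (D a v) (e.eval s))) (e.size + 104) := by
  have hset : ∀ x, (s.setReal d u v x).HasPivot D a := fun x =>
    h.of_eqOff (Store.eqOff_setReal ∅ (Finset.mem_singleton_self d) _ _ _ _)
      (hinput := by simpa using hd.symm)
  have hrow : ∀ x, (pivotDist rowVar).eval (s.setReal d u v x) = D a u := fun x =>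
    eval_pivotDist (hset x) hu
  have hcol : ∀ x, (pivotDist colVar).eval (s.setReal d u v x) = D a v := fun x =>
    eval_pivotDist (hset x) hv
  have hrun : Runs O (clampProg d e) s _ _ :=
    (runs_assignProg hu hv d e).seq ((runs_minProg (by exact hu) (by exact hv) d _).seq
      ((runs_maxProg (by exact hu) (by exact hv) d _).seq
        (runs_maxProg (by exact hu) (by exact hv) d _)))
  simp only [RExp.eval, Store.setReal_real_self, Store.setReal_setReal, hrow, hcol] at hrun
  refine hrun.mono ?_
  simp only [RExp.size, pivotDist, size_nvar]
  omega

theorem runs_offDiagProg (hu : s.int rowVar 0 = u) (hv : s.int colVar 0 = v) {d B : ℕ} {p : Prog}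
    {x : ℝ} (hp : Runs O p s (s.setReal d u v x) B) :
    Runs O (offDiagProg d p) s (s.setReal d u v (if u = v then 0 else x)) (B + 18) := by
  have htest : BExp.holds s (.and (.leN (nvar rowVar) (nvar colVar))
      (.leN (nvar colVar) (nvar rowVar))) ↔ u = v := by
    simp only [BExp.holds, eval_nvar, hu, hv, ← le_antisymm_iff, Fin.ext_iff]
  split_ifs with h
  · have hzero := runs_assignProg (O := O) hu hv d (.ofNat (.const 0))
    simp only [RExp.eval, NExp.eval, Nat.cast_zero] at hzero
    refine (Runs.ite_true (htest.mpr h) hzero).mono ?_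
    simp only [BExp.size, RExp.size, NExp.size, size_nvar]
    omega
  · refine (Runs.ite_false (mt htest.mp h) hp).mono ?_
    simp only [BExp.size, size_nvar]
    omega

theorem runs_queryProg (h : s.HasPivot D a) (hr : s.real radiusArr 0 0 = radius D a) :
    ∃ s', Runs O queryProg s s' ((gridCost 160).eval n) ∧
      s.EqOff {rowVar, colVar} {queryArr} s' ∧ s'.read queryArr n = pivotQuery D a := by
  refine Runs.fill (pivotQuery D a) h.size fun s₁ u v hs₁ hu hv => ?_
  have hclamp := runs_clampProg (O := O) (h.of_eqOff hs₁) hu hv (d := queryArr) (by decide)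
    (gridCell inputArr)
  rw [eval_gridCell (h.of_eqOff hs₁).input hu hv] at hclamp
  have hframe : s.EqOff {rowVar, colVar} {queryArr}
      (s₁.setReal queryArr u v (triangleClamp (D a u) (D a v) (D u v))) :=
    hs₁.trans (Store.eqOff_setReal _ (by decide) _ _ _ _)
  have hassign := runs_assignProg (O := O) (u := u) (v := v) (s := s₁.setReal queryArr u v
    (triangleClamp (D a u) (D a v) (D u v))) hu hv queryArr (.add (gridCell queryArr) slackExp)
  have hr' := hframe.real radiusArr (by decide)
  rw [RExp.eval, eval_gridCell (s := s₁.setReal queryArr u v _) rfl hu hv, Store.read,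
    Store.setReal_real_self, eval_slackExp (h.of_eqOff hframe) (by rw [hr', hr]) hu hv,
    Store.setReal_setReal] at hassign
  exact (runs_offDiagProg hu hv (hclamp.seq hassign)).mono (by decide)

theorem runs_treeProg (h : s.HasPivot D a) (hr : s.real radiusArr 0 0 = radius D a) {R : Mat n}
    (hR : s.read answerArr n = R) :
    ∃ s', Runs O treeProg s s' ((gridCost 160).eval n) ∧
      s.EqOff {rowVar, colVar} {treeArr} s' ∧ s'.read treeArr n = pivotTree D a R := by
  refine Runs.fill (pivotTree D a R) h.size fun s₁ u v hs₁ hu hv => ?_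
  have hclamp := runs_clampProg (O := O) (h.of_eqOff hs₁) hu hv (d := treeArr) (by decide)
    (.sub (gridCell answerArr) slackExp)
  rw [RExp.eval, eval_gridCell (M := R) (by rw [hs₁.read (by decide), hR]) hu hv,
    eval_slackExp (h.of_eqOff hs₁) (by rw [hs₁.real _ (by decide), hr]) hu hv] at hclamp
  exact (runs_offDiagProg hu hv hclamp).mono (by decide)

theorem runs_countProg (h : s.HasPivot D a) {M : Mat n} (hM : s.read treeArr n = M) :
    ∃ s', Runs O countProg s s' ((gridCost 40).eval n + 3) ∧
      s.EqOff {rowVar, colVar, countVar} ∅ s' ∧ s'.int countVar 0 = disagreements M D := by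
  classical
  let differ : Fin n × Fin n → Prop := fun uv => uv.1 < uv.2 ∧ M uv.1 uv.2 ≠ D uv.1 uv.2
  obtain ⟨s', hrun, hframe, hs'⟩ := Runs.gridLoop (O := O) (B := 40)
    (p := .ite (.and (.not (.leN (nvar colVar) (nvar rowVar)))
      (.not (.and (.leR (gridCell treeArr) (gridCell inputArr))
        (.leR (gridCell inputArr) (gridCell treeArr)))))
      (.setN countVar (.const 0) (.add (nvar countVar) (.const 1))) .nop)
    (s := s.setInt countVar 0 0)
    (fun S s' => s.EqOff {rowVar, colVar, countVar} ∅ s' ∧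
      s'.int countVar 0 = (S.filter differ).card)
    (fun S s' hs' => (h.of_eqOff hs'.1).size)
    (fun S s' x hs' => ⟨hs'.1.trans (Store.eqOff_setInt (by decide) _ _ _ _), hs'.2⟩)
    (fun S s' x hs' => ⟨hs'.1.trans (Store.eqOff_setInt (by decide) _ _ _ _), hs'.2⟩)
    (fun S u v huv s₁ hs₁ hu hv => by
      have htree : (gridCell treeArr).eval s₁ = M u v :=
        eval_gridCell (by rw [hs₁.1.read (by decide), hM]) hu hv
      have hinput := eval_gridCell (h.of_eqOff hs₁.1).input hu hv
      by_cases hdiff : differ (u, v)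
      · refine ⟨_, (Runs.ite_true ?_ (Runs.setN s₁ countVar _ _)).mono (by decide), hu, hv,
          hs₁.1.trans (Store.eqOff_setInt (by decide) _ _ _ _), ?_⟩
        · simp only [BExp.holds, eval_nvar, hu, hv, htree, hinput, not_le, ← le_antisymm_iff]
          exact hdiff
        · rw [Finset.filter_insert, if_pos hdiff, Finset.card_insert_of_notMem (by simp [huv]),
            ← hs₁.2]
          simp only [NExp.eval, eval_nvar, Store.setInt_int_self]
      · refine ⟨s₁, (Runs.ite_false ?_ (Runs.nop s₁)).mono (by decide), hu, hv, hs₁.1, ?_⟩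
        · simp only [BExp.holds, eval_nvar, hu, hv, htree, hinput, not_le, ← le_antisymm_iff]
          exact hdiff
        · rw [Finset.filter_insert, if_neg hdiff, hs₁.2])
    ⟨Store.eqOff_setInt (by decide) _ _ _ _, by simp⟩
  refine ⟨s', ((Runs.setN s countVar (.const 0) (.const 0)).seq hrun).mono ?_, hframe, ?_⟩
  · simp only [NExp.size]
    omega
  · rw [hs', disagreements]

variable {M : Fin n → Mat n} {S : Finset (Fin n)}

theorem Store.HoldsBest.of_eqOff {I R : Finset ℕ} {s' : Store} (h : s.HoldsBest D M S)
    (hs : s.EqOff I R s') (hint : bestVar ∉ I := by decide) (hreal : bestArr ∉ R := by decide) :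
    s'.HoldsBest D M S := by
  unfold Store.HoldsBest
  rwa [hs.int _ hint, hs.read hreal]

theorem Store.HoldsBest.insert_of_le (h : s.HoldsBest D M S) (hpos : 1 ≤ s.int bestVar 0)
    (hle : s.int bestVar 0 ≤ disagreements (M a) D + 1) : s.HoldsBest D M (insert a S) := by
  rcases h with ⟨-, h⟩ | ⟨b, hb, hread, hbest, hmin⟩
  · omega
  · refine .inr ⟨b, Finset.mem_insert_of_mem hb, hread, hbest, ?_⟩
    exact Finset.forall_mem_insert _ _ _ |>.mpr ⟨by omega, hmin⟩

theorem Store.HoldsBest.disagreements_le (h : s.HoldsBest D M S) {k : ℕ}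
    (hk : ¬ (1 ≤ s.int bestVar 0 ∧ s.int bestVar 0 ≤ k + 1)) :
    ∀ b ∈ S, k ≤ disagreements (M b) D := by
  rcases h with ⟨rfl, -⟩ | ⟨c, -, -, hbest, hmin⟩
  · simp
  · intro b hb
    have := hmin b hb
    omega

theorem runs_keepProg (hsize : s.int sizeVar 0 = n) (h : s.HoldsBest D M S)
    (hM : s.read treeArr n = M a) (hcount : s.int countVar 0 = disagreements (M a) D) :
    ∃ s', Runs O keepProg s s' (keepCost.eval n) ∧
      s.EqOff {rowVar, colVar, bestVar} {bestArr} s' ∧ s'.HoldsBest D M (insert a S) := by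
  have htest : BExp.holds s (.and (.leN (.const 1) (nvar bestVar))
      (.leN (nvar bestVar) (.add (nvar countVar) (.const 1)))) ↔
      1 ≤ s.int bestVar 0 ∧ s.int bestVar 0 ≤ disagreements (M a) D + 1 := by
    simp only [BExp.holds, NExp.eval, eval_nvar, hcount]
  by_cases hkeep : 1 ≤ s.int bestVar 0 ∧ s.int bestVar 0 ≤ disagreements (M a) D + 1
  · refine ⟨s, (Runs.ite_true (htest.mpr hkeep) (Runs.nop s)).mono ?_, .refl _ _ _,
      h.insert_of_le hkeep.1 hkeep.2⟩
    simp [BExp.size, NExp.size, keepCost]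
  · obtain ⟨s₁, hrun, hframe, hread⟩ := Runs.fill (O := O)
      (p := assignProg bestArr (gridCell treeArr)) (d := bestArr) (B := 10) (M a) hsize
      fun s₁ u v hs₁ hu hv => by
        have hassign := runs_assignProg (O := O) hu hv bestArr (gridCell treeArr)
        rwa [eval_gridCell (by rw [hs₁.read (by decide), hM]) hu hv] at hassign
    have hcount₁ : s₁.int countVar 0 = disagreements (M a) D := by
      rw [hframe.int _ (by decide), hcount]
    have hset := Runs.setN (O := O) s₁ bestVar (.const 0) (.add (nvar countVar) (.const 1))
    simp only [NExp.eval, eval_nvar, hcount₁] at hset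
    refine ⟨_, (Runs.ite_false (mt htest.mp hkeep) (hrun.seq hset)).mono ?_, ?_, ?_⟩
    · simp only [BExp.size, NExp.size, size_nvar, keepCost, Polynomial.eval_add,
        Polynomial.eval_ofNat]
      omega
    · exact (hframe.mono (by decide) subset_rfl).trans
        (Store.eqOff_setInt (by decide) _ _ _ _)
    · exact .inr ⟨a, Finset.mem_insert_self _ _, hread, Store.setInt_int_self _ _ _ _,
        Finset.forall_mem_insert _ _ _ |>.mpr ⟨le_rfl, h.disagreements_le hkeep⟩⟩

theorem runs_pivotProg (h : s.HasPivot D a) {R : Mat n} {c : ℕ}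
    (hO : O n (pivotQuery D a) = some (R, c)) (hM : M a = pivotTree D a R)
    (hbest : s.HoldsBest D M S) :
    ∃ s', Runs O pivotProg s s' (c + pivotCost.eval n) ∧ s'.HasPivot D a ∧
      s'.HoldsBest D M (insert a S) := by
  obtain ⟨s₁, hrun₁, hframe₁, hr₁⟩ := runs_radiusProg (O := O) h
  have h₁ := h.of_eqOff hframe₁
  obtain ⟨s₂, hrun₂, hframe₂, hquery⟩ := runs_queryProg (O := O) h₁ hr₁
  have h₂ := h₁.of_eqOff hframe₂
  have horacle : Runs O (.oracle (nvar sizeVar) queryArr answerArr) s₂ _ _ :=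
    Runs.oracle h₂.size (hquery ▸ hO)
  have hframe₃ : s₂.EqOff ∅ {answerArr} (s₂.write answerArr R) :=
    Store.eqOff_write _ (by decide) _ _
  have h₃ := h₂.of_eqOff hframe₃
  obtain ⟨s₄, hrun₄, hframe₄, htree⟩ := runs_treeProg (O := O) h₃
    (by rw [hframe₃.real _ (by decide), hframe₂.real _ (by decide), hr₁])
    (Store.read_write _ _ _)
  have h₄ := h₃.of_eqOff hframe₄
  rw [← hM] at htree
  obtain ⟨s₅, hrun₅, hframe₅, hcount⟩ := runs_countProg (O := O) h₄ htree
  have h₅ := h₄.of_eqOff hframe₅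
  have hbest₅ := ((((hbest.of_eqOff hframe₁).of_eqOff hframe₂).of_eqOff hframe₃).of_eqOff
    hframe₄).of_eqOff hframe₅
  obtain ⟨s₆, hrun₆, hframe₆, hbest₆⟩ := runs_keepProg (O := O) h₅.size hbest₅
    (by rw [hframe₅.read (by decide), htree]) hcount
  refine ⟨s₆, (hrun₁.seq (hrun₂.seq (horacle.seq
    (hrun₄.seq (hrun₅.seq hrun₆))))).mono ?_, h₅.of_eqOff hframe₆, hbest₆⟩
  simp only [size_nvar, pivotCost, Polynomial.eval_add, Polynomial.eval_mul, Polynomial.eval_X,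
    Polynomial.eval_ofNat, Polynomial.eval_pow]
  omega

theorem runs_fitTreeProg {t : ℕ} {R : Fin n → Mat n}
    (hO : ∀ a, ∃ c ≤ t, O n (pivotQuery D a) = some (R a, c)) :
    ∃ s, Runs O fitTreeProg (Store.init D) s (n * t + (loopCost pivotCost).eval n) ∧
      s.HoldsBest D (fun a => pivotTree D a (R a)) Finset.univ := by
  obtain ⟨s, hrun, -, -, hs⟩ := Runs.forLoop (O := O) (v := pivotVar) (p := pivotProg)
    (B := t + pivotCost.eval n) (s := Store.init D)
    (fun S s => s.int sizeVar 0 = n ∧ s.read inputArr n = D ∧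
      s.HoldsBest D (fun a => pivotTree D a (R a)) S)
    (fun S s hs => hs.1)
    (fun S s x hs =>
      have hset : s.EqOff {pivotVar} ∅ (s.setInt pivotVar 0 x) :=
        Store.eqOff_setInt (by decide) _ _ _ _
      ⟨hs.1, hs.2.1, hs.2.2.of_eqOff hset⟩)
    (fun S a _ s hs ha => by
      obtain ⟨c, hc, hOa⟩ := hO a
      obtain ⟨s', hrun, hpivot, hbest⟩ := runs_pivotProg ⟨hs.1, hs.2.1, ha⟩ hOa rfl hs.2.2
      exact ⟨s', hrun.mono (Nat.add_le_add_right hc _), hpivot.pivot, hpivot.size, hpivot.input,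
        hbest⟩)
    ⟨by simp [Store.init], by funext u v; simp [Store.init, Store.read],
      .inl ⟨rfl, by simp [Store.init]⟩⟩
  refine ⟨s, hrun.mono ?_, hs⟩
  rw [eval_loopCost]
  ring_nf
  rfl

end Correctness

/-! ### Approximation algorithms -/

section Approximation

variable {Feasible : ∀ {n : ℕ}, Mat n → Prop} {O O' : Oracle} {A P : Prog} {ρ ρ' : ℝ} {t : ℕ → ℕ}

theorem IsApproxAlgorithm.mono (h : IsApproxAlgorithm Feasible O P ρ t) (hρ : ρ ≤ ρ') :
    IsApproxAlgorithm Feasible O P ρ' t := by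
  intro n D hD
  obtain ⟨R, c, hP, ⟨hR, happrox⟩, hc⟩ := h n D hD
  exact ⟨R, c, hP, ⟨hR, fun S hS => (happrox S hS).trans (by gcongr)⟩, hc⟩

theorem Exec.subst (hA : ∀ (n : ℕ) (D R : Mat n) (c : ℕ), O n D = some (R, c) →
      A.Computes O' D R c) {s s' : Store} {c : ℕ} (h : Exec O P s s' c) :
    Exec O' (P.subst A) s s' c := by
  induction h with
  | nop s => exact .nop s
  | setN s a i e => exact .setN s a i e
  | setR s a i j e => exact .setR s a i j e
  | seq _ _ ihp ihq => exact .seq ihp ihq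
  | ite_true hb _ ih => exact .ite_true hb ih
  | ite_false hb _ ih => exact .ite_false hb ih
  | loop_true hb _ _ ihp ihloop => exact .loop_true hb ihp ihloop
  | loop_false hb => exact .loop_false hb
  | oracle hO =>
    obtain ⟨s', hs', rfl⟩ := hA _ _ _ _ hO
    exact .call hs'
  | call _ ih => exact .call ih

theorem IsApproxAlgorithm.subst
    (hA : ∀ (n : ℕ) (D R : Mat n) (c : ℕ), O n D = some (R, c) → A.Computes O' D R c)
    (hP : IsApproxAlgorithm Feasible O P ρ t) : IsApproxAlgorithm Feasible O' (P.subst A) ρ t := by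
  intro n D hD
  obtain ⟨R, c, ⟨s, hs, hR⟩, h⟩ := hP n D hD
  exact ⟨R, c, ⟨s, hs.subst hA, hR⟩, h⟩

theorem IsApproxAlgorithm.exists_oracle (hA : IsApproxAlgorithm Feasible O' A ρ t) :
    ∃ O : Oracle, IsApproxOracle Feasible O ρ t ∧
      ∀ (n : ℕ) (D R : Mat n) (c : ℕ), O n D = some (R, c) → A.Computes O' D R c := by
  classical
  choose R c hcomp happrox using hA
  refine ⟨fun n D => if hD : IsDistanceMatrix D then some (R n D hD, c n D hD) else none,
    fun n D hD => ⟨_, _, dif_pos hD, happrox n D hD⟩, fun n D R' c' h => ?_⟩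
  by_cases hD : IsDistanceMatrix D
  · obtain ⟨rfl, rfl⟩ := Prod.mk.inj (Option.some.inj ((dif_pos hD).symm.trans h))
    exact hcomp n D hD
  · exact absurd ((dif_neg hD).symm.trans h) (Option.some_ne_none _).symm

end Approximation

/-! ### The reduction -/

theorem isTreeMetric_of_size_zero (M : Mat 0) : IsTreeMetric M :=
  isTreeMetric_of_strong_triangle (U := M) (c := 0) (fun u => u.elim0) (fun u => u.elim0)
    (fun u => u.elim0) (fun u => u.elim0) (fun u => u.elim0)

theorem isApproxAlgorithm_fitTreeProg {O : Oracle} {ρ : ℝ} (hρ : 0 ≤ ρ) {t : ℕ → ℕ}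
    (hO : IsApproxOracle IsUltrametric O ρ t) :
    IsApproxAlgorithm IsTreeMetric O fitTreeProg (3 * (ρ + 1))
      (fun n => n * t n + (loopCost pivotCost).eval n) := by
  intro n D hD
  choose R c hOR hR hc using fun a => hO n (pivotQuery D a) (isDistanceMatrix_pivotQuery hD a)
  obtain ⟨s, ⟨d, hd, hs⟩, hbest⟩ := runs_fitTreeProg fun a => ⟨c a, hc a, hOR a⟩
  refine ⟨s.read bestArr n, d, ⟨s, hs, rfl⟩, ?_, hd⟩
  rcases n.eq_zero_or_pos with rfl | hn
  · exact ⟨isTreeMetric_of_size_zero _, fun S _ => by simp [disagreements]⟩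
  have : NeZero n := ⟨hn.ne'⟩
  rcases hbest with ⟨hempty, -⟩ | ⟨a, -, hread, -, hmin⟩
  · exact absurd hempty Finset.univ_nonempty.ne_empty
  rw [hread]
  refine ⟨isTreeMetric_pivotTree D a (hR a).1, fun T hT => ?_⟩
  obtain ⟨b, hb⟩ := exists_disagreements_pivotTree_le hD hρ hR hT
  exact le_trans (mod_cast hmin b (Finset.mem_univ b)) hb

end L0Fit

theorem theorem1_general :
    ∃ (P : L0Fit.Prog) (q : Polynomial ℕ), ∀ (ρ : ℝ), 0 ≤ ρ → ∀ t : ℕ → ℕ,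
      (∀ O : L0Fit.Oracle, L0Fit.IsApproxOracle L0Fit.IsUltrametric O ρ t →
        L0Fit.IsApproxAlgorithm L0Fit.IsTreeMetric O P (3 * (ρ + 1))
          (fun n => n * t n + q.eval n)) ∧
      (∀ (O : L0Fit.Oracle) (A : L0Fit.Prog),
        L0Fit.IsApproxAlgorithm L0Fit.IsUltrametric O A ρ t →
        L0Fit.IsApproxAlgorithm L0Fit.IsTreeMetric O (P.subst A) (3 * (ρ + 1))
          (fun n => n * t n + q.eval n)) := by
  refine ⟨L0Fit.fitTreeProg, L0Fit.loopCost L0Fit.pivotCost, fun ρ hρ t =>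
    ⟨fun O hO => L0Fit.isApproxAlgorithm_fitTreeProg hρ hO, fun O A hA => ?_⟩⟩
  obtain ⟨O', hO', hcomputes⟩ := hA.exists_oracle
  exact (L0Fit.isApproxAlgorithm_fitTreeProg hρ hO').subst hcomputes

/-- One oracle program `P`, independent of the factor and of the black box, turns every factor `ρ`
approximation for `L₀` Fitting Ultrametrics into a factor `6 ρ` approximation for `L₀` Fitting Tree
Metrics with polynomial overhead: for black boxes of any kind, and for programs put in the place of
the oracle. -/
theorem theorem1 :
    ∃ (P : L0Fit.Prog) (q : Polynomial ℕ), ∀ (ρ : ℝ), 1 ≤ ρ → ∀ t : ℕ → ℕ,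
      (∀ O : L0Fit.Oracle, L0Fit.IsApproxOracle L0Fit.IsUltrametric O ρ t →
        L0Fit.IsApproxAlgorithm L0Fit.IsTreeMetric O P (6 * ρ)
          (fun n => n * t n + q.eval n)) ∧
      (∀ A : L0Fit.Prog, L0Fit.IsApproxAlgorithm L0Fit.IsUltrametric L0Fit.noOracle A ρ t →
        L0Fit.IsApproxAlgorithm L0Fit.IsTreeMetric L0Fit.noOracle (P.subst A) (6 * ρ)
          (fun n => n * t n + q.eval n)) := by
  obtain ⟨P, q, h⟩ := theorem1_general
  refine ⟨P, q, fun ρ hρ t => ⟨fun O hO => ?_, fun A hA => ?_⟩⟩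
  · exact ((h ρ (by linarith) t).1 O hO).mono (by linarith)
  · exact ((h ρ (by linarith) t).2 L0Fit.noOracle A hA).mono (by linarith)
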